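/- Let $N\ge 2$ be an integer and let $\Omega_N$ be the hierarchical lattice of order $N$: the set of sequences $x=(x_1,x_2,\dots)$ with $x_i\in\mathbb Z/N\mathbb Z$ and only finitely many $x_i\neq 0$, with the ultrametric $d(x,y)=\max\{i: x_i\ne y_i\}$ for $x\neq y$ and $d(x,x)=0$. Let $\delta>-1$ and $c_k>0$ $(k\ge 1)$. Let $\mathcal G_N$ be the random graph with vertex set $\Omega_N$ in which any two distinct points $x,y$ with $d(x,y)=k$ are joined by an edge with probability $\min\left(c_k/N^{k(1+\delta)},1\right)$, independently for all pairs (realized by independent uniform $[0,1]$ variables, one for each unordered pair). Percolation is said to occur if, with positive probability, the origin $\mathbf 0$ lies in an infinite connected component (an infinite cluster) of $\mathcal G_N$. For $k\ge 0$ let $B_k=\{x: d(\mathbf 0,x)\le k\}$, and let $X_k$ be a largest connected component of the subgraph of $\mathcal G_N$ induced on $B_k$ (only connections within $B_k$ are considered). For $0<\gamma<1$, $B_k$ is called $\gamma$-good if $|X_k|\ge N^{\gamma k}$. Let $k_n=\lfloor n\log n\rfloor$. (a) If $\delta>1$ and $\sup_k c_k<\infty$, then percolation does not occur. (b) If $-1<\delta<1$,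 there is a constant $c_*$, depending only on $N$ and $\delta$, such that the following holds for every sequence $(c_k)$ of positive numbers with $\inf_k c_k\ge c_*$. (i) Percolation occurs. (ii) It occurs through a chain of clusters in the balls $B_{k_n}$: for every $\gamma$ with $\frac{1+\delta}{2}<\gamma<1$, with probability $1$ there is an $m$ such that for all $n\ge m$ the ball $B_{k_n}$ is $\gamma$-good and $X_{k_n}\subseteq X_{k_{n+1}}$; and with positive probability there is such an $m$ for which moreover $\mathbf 0\in X_{k_m}$. Both statements hold for every choice of the largest clusters in the balls that have several. (iii) With probability $1$, $\mathcal G_N$ has exactly one infinite cluster. -/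

import Mathlib

open MeasureTheory

namespace HierPerc

/-- The hierarchical group `Ω_N`: sequences `(x₁, x₂, …)` with entries in `ℤ/N`, only finitely many
of them nonzero, with componentwise addition. -/
abbrev HGroup (N : ℕ) : Type := ℕ+ →₀ ZMod N

/-- The hierarchical distance: the largest index `i ≥ 1` with `x i ≠ y i`, and `0` if `x = y`. -/
def hdist {N : ℕ} (x y : HGroup N) : ℕ :=
  (Finsupp.neLocus x y).sup (fun i : ℕ+ => (i : ℕ))

/-- The `k`-ball that contains the origin. -/
def ball (N k : ℕ) : Set (HGroup N) := {x | hdist 0 x ≤ k}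

/-- The connection probability `min (c_k / N ^ (k (1 + δ)), 1)` of two points at distance `k`. -/
noncomputable def connProb (N : ℕ) (δ : ℝ) (c : ℕ → ℝ) (k : ℕ) : ℝ :=
  min (c k / (N : ℝ) ^ ((k : ℝ) * (1 + δ))) 1

/-- The sample space: one number in `[0, 1]` for every unordered pair of points. -/
abbrev Sample (N : ℕ) : Type := Sym2 (HGroup N) → unitInterval

/-- The law of a family of independent uniform random variables on `[0, 1]`. -/
noncomputable def law (N : ℕ) : Measure (Sample N) :=
  Measure.infinitePi (fun _ : Sym2 (HGroup N) => (volume : Measure unitInterval))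

/-- The random graph: distinct points `x`, `y` are joined by an edge if and only if the uniform
variable of the pair `{x, y}` is at most the connection probability at distance `hdist x y`. -/
def graph (N : ℕ) (δ : ℝ) (c : ℕ → ℝ) (U : Sample N) : SimpleGraph (HGroup N) :=
  SimpleGraph.fromRel (fun x y => ((U s(x, y) : unitInterval) : ℝ) ≤ connProb N δ c (hdist x y))

/-- Percolation occurs: the origin lies in an infinite cluster with positive probability. -/
def Percolates (N : ℕ) (δ : ℝ) (c : ℕ → ℝ) : Prop :=
  0 < law N {U | ((graph N δ c U).connectedComponentMk 0).supp.Infinite}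

/-- The clusters of the `k`-ball around the origin, where only connections within the ball are
considered: the connected components of the subgraph that `G` induces on the ball. -/
def ballClusters {N : ℕ} (G : SimpleGraph (HGroup N)) (k : ℕ) : Set (Set (HGroup N)) :=
  {C | ∃ K : (G.induce (ball N k)).ConnectedComponent, C = Subtype.val '' K.supp}

/-- `C` is a largest cluster of the `k`-ball around the origin. (There may be several.) -/
def IsLargestCluster {N : ℕ} (G : SimpleGraph (HGroup N)) (k : ℕ) (C : Set (HGroup N)) : Prop :=
  C ∈ ballClusters G k ∧ ∀ D ∈ ballClusters G k, D.ncard ≤ C.ncard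

/-- The `k`-ball around the origin is `γ`-good: its largest cluster has at least `N ^ (γ k)`
points. -/
def IsGood {N : ℕ} (G : SimpleGraph (HGroup N)) (γ : ℝ) (k : ℕ) : Prop :=
  ∃ C, IsLargestCluster G k C ∧ (N : ℝ) ^ (γ * (k : ℝ)) ≤ (C.ncard : ℝ)

/-- The distances `k_n = ⌊n log n⌋`. -/
noncomputable def kseq (n : ℕ) : ℕ := ⌊(n : ℝ) * Real.log n⌋₊

/-- From index `m` on, all the `k_n`-balls around the origin are `γ`-good and their largest clusters
form an increasing chain, whichever largest cluster is chosen in a ball that has several. -/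
def ChainFrom {N : ℕ} (G : SimpleGraph (HGroup N)) (γ : ℝ) (m : ℕ) : Prop :=
  ∀ n, m ≤ n → IsGood G γ (kseq n) ∧
    ∀ C C', IsLargestCluster G (kseq n) C → IsLargestCluster G (kseq (n + 1)) C' → C ⊆ C'

end HierPerc

/-! ### Ultrametric balls and their partition into smaller balls. -/

namespace HierPerc

/-! For `δ > 1` the expected number of edges leaving the `k`-ball around the origin is of order `N ^
((1 - δ) k)`. It tends to zero, while an infinite cluster of the origin needs such an edge for every
`k` (`not_percolates`).

For `δ < 1` the proof is a renormalization. With `c ≥ N ^ ((1 + δ) K)` all balls of radius at most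
`K` are complete graphs. At a larger scale `k`, divide a `k`-ball into `l`-balls with `l = k - k /
A`. Two majority clusters (more than half of their `l`-balls) have on average at least of order `N ^
(2 l - (1 + δ) k)` edges between them, so they fail to be joined with superexponentially small
probability. If at most one `l`-ball lacks a dense cluster and all pairs are joined, then the
`k`-ball has a cluster of almost the same density. Two bad `l`-balls are independent events, so the
failure probability is essentially squared. This preserves the bound `N ^ (-2 k)`, with density `3 /
4 + 1 / k` (`IsBaseScale.prob_not_hasCluster_le`).

Hence `Linked G k` fails with summable probability, and almost surely it holds from some scale on. A
majority cluster is the unique largest cluster of its ball and, under `Linked`, is contained in the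
next one. This gives the chain and an infinite cluster. The sum of the failure probabilities from
`K` on is at most `1 / 2`, so with positive probability there is no failure and the origin takes
part.

For uniqueness, follow the cluster of `x` in growing balls. Given the edges at distance at most `k`,
all edges from it to the next shell are equally likely. If majority clusters fill half of the shell,
an exit that misses them is at most as likely as a hit (`prob_exit_le_prob_hit`). First hits at
different scales are disjoint, so these misses are summable. Almost surely, an infinite cluster that
never hits would have only finitely many exits, which is impossible (`reachable_of_linked`). -/

theorem hdist_le_iff {N : ℕ} {x y : HGroup N} {k : ℕ} :
    hdist x y ≤ k ↔ ∀ i : ℕ+, k < (i : ℕ) → x i = y i := by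
  rw [hdist, Finset.sup_le_iff]
  constructor
  · intro h i hi
    by_contra hne
    exact absurd (h i (Finsupp.mem_neLocus.2 hne)) (not_le.2 hi)
  · intro h i hi
    by_contra hlt
    exact Finsupp.mem_neLocus.1 hi (h i (not_le.1 hlt))

theorem hdist_comm {N : ℕ} (x y : HGroup N) : hdist x y = hdist y x := by
  rw [hdist, hdist, Finsupp.neLocus_comm]

theorem hdist_self {N : ℕ} (x : HGroup N) : hdist x x = 0 := by
  simp [hdist]

theorem hdist_le_trans {N : ℕ} {x y z : HGroup N} {k : ℕ} (h : hdist x y ≤ k)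
    (h' : hdist y z ≤ k) : hdist x z ≤ k := by
  rw [hdist_le_iff] at *
  exact fun i hi => (h i hi).trans (h' i hi)

theorem hdist_pos {N : ℕ} {x y : HGroup N} (h : x ≠ y) : 1 ≤ hdist x y := by
  by_contra hlt
  refine h (Finsupp.ext fun i => hdist_le_iff.1 (by omega : hdist x y ≤ 0) i i.pos)

/-- The ball of radius `k` around `x`. -/
def cell {N : ℕ} (x : HGroup N) (k : ℕ) : Set (HGroup N) := {y | hdist x y ≤ k}

theorem mem_cell {N : ℕ} {x y : HGroup N} {k : ℕ} : y ∈ cell x k ↔ hdist x y ≤ k := Iff.rfl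

theorem mem_cell_self {N : ℕ} (x : HGroup N) (k : ℕ) : x ∈ cell x k := by
  rw [mem_cell, hdist_self]; exact Nat.zero_le k

theorem mem_cell_comm {N : ℕ} {x y : HGroup N} {k : ℕ} : y ∈ cell x k ↔ x ∈ cell y k := by
  rw [mem_cell, mem_cell, hdist_comm]

theorem cell_eq_of_mem {N : ℕ} {x y : HGroup N} {k : ℕ} (h : y ∈ cell x k) :
    cell y k = cell x k := by
  ext z
  exact ⟨fun hz => hdist_le_trans h hz, fun hz => hdist_le_trans (mem_cell_comm.1 h) hz⟩

theorem cell_mono {N : ℕ} (x : HGroup N) {k l : ℕ} (h : k ≤ l) : cell x k ⊆ cell x l :=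
  fun _ hy => le_trans hy h

theorem cell_subset_of_mem {N : ℕ} {x y : HGroup N} {k l : ℕ} (hkl : l ≤ k) (h : y ∈ cell x k) :
    cell y l ⊆ cell x k :=
  (cell_mono y hkl).trans (cell_eq_of_mem h).subset

open Classical in
theorem cell_finite_and_ncard {N : ℕ} [NeZero N] (x : HGroup N) (k : ℕ) :
    (cell x k).Finite ∧ (cell x k).ncard = N ^ k := by
  let s : Finset ℕ+ := (Finset.range k).image Nat.succPNat
  have hs : ∀ i : ℕ+, i ∈ s ↔ (i : ℕ) ≤ k := by
    intro i
    simp only [s, Finset.mem_image, Finset.mem_range]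
    constructor
    · rintro ⟨a, ha, rfl⟩
      simpa using ha
    · intro h
      refine ⟨i.natPred, ?_, PNat.succPNat_natPred i⟩
      have := PNat.natPred_add_one i
      omega
  have hcard : s.card = k := by
    rw [Finset.card_image_of_injective _ Nat.succPNat_injective, Finset.card_range]
  let F : Finset (HGroup N) := s.finsupp fun _ => Finset.univ
  -- The ball is the translate by `x` of the finite group of vectors supported on the coordinates
  -- `1, …, k`.
  have hF : cell x k = (fun f => x + f) '' (F : Set (HGroup N)) := by
    ext y
    simp only [Set.mem_image, Finset.mem_coe, F, Finset.mem_finsupp_iff, Finset.mem_univ,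
      implies_true, and_true]
    rw [mem_cell, hdist_le_iff]
    constructor
    · intro h
      refine ⟨y - x, ?_, by abel⟩
      intro i hi
      rw [hs]
      by_contra hlt
      rw [Finsupp.mem_support_iff, Finsupp.sub_apply, h i (not_le.1 hlt), sub_self] at hi
      exact hi rfl
    · rintro ⟨f, hf, rfl⟩ i hi
      have : f i = 0 := by
        by_contra hne
        have := (hs i).1 (hf (Finsupp.mem_support_iff.2 hne))
        omega
      simp [this]
  have hinj : Function.Injective fun f : HGroup N => x + f := add_right_injective x
  rw [hF]
  refine ⟨F.finite_toSet.image _, ?_⟩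
  rw [Set.ncard_image_of_injective _ hinj, Set.ncard_coe_finset, Finset.card_finsupp]
  simp [hcard, ZMod.card]

theorem cell_finite {N : ℕ} [NeZero N] (x : HGroup N) (k : ℕ) : (cell x k).Finite :=
  (cell_finite_and_ncard x k).1

theorem cell_ncard {N : ℕ} [NeZero N] (x : HGroup N) (k : ℕ) : (cell x k).ncard = N ^ k :=
  (cell_finite_and_ncard x k).2

/-- The point with the coordinates of `x` beyond `l`, and zeros up to `l`. -/
noncomputable def trunc {N : ℕ} (l : ℕ) (x : HGroup N) : HGroup N :=
  x.filter fun i => l < (i : ℕ)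

theorem trunc_apply {N : ℕ} (l : ℕ) (x : HGroup N) (i : ℕ+) :
    trunc l x i = if l < (i : ℕ) then x i else 0 := by
  classical
  rw [trunc, Finsupp.filter_apply]

theorem trunc_mem_cell {N : ℕ} (l : ℕ) (x : HGroup N) : trunc l x ∈ cell x l := by
  rw [mem_cell, hdist_le_iff]
  intro i hi
  rw [trunc_apply, if_pos hi]

/-- Canonical representatives make the `l`-balls the fibres of `trunc l`, so that counting over
`l`-balls becomes a sum over fibres. -/
theorem trunc_eq_iff {N : ℕ} {l : ℕ} {x y : HGroup N} : trunc l x = trunc l y ↔ y ∈ cell x l := by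
  constructor
  · intro h
    have h' := trunc_mem_cell l y
    rw [← h] at h'
    exact hdist_le_trans (trunc_mem_cell l x) (mem_cell_comm.1 h')
  · intro h
    ext i
    rw [trunc_apply, trunc_apply]
    split_ifs with hi
    · exact hdist_le_iff.1 h i hi
    · rfl

open Classical in
/-- Representatives of the balls of radius `l` in the ball of radius `k` around `x`. -/
noncomputable def reps {N : ℕ} [NeZero N] (x : HGroup N) (k l : ℕ) : Finset (HGroup N) :=
  (cell_finite x k).toFinset.image (trunc l)

theorem trunc_mem_reps {N : ℕ} [NeZero N] {x y : HGroup N} {k : ℕ} (l : ℕ) (h : y ∈ cell x k) :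
    trunc l y ∈ reps x k l := by
  classical
  exact Finset.mem_image_of_mem _ ((cell_finite x k).mem_toFinset.2 h)

theorem mem_cell_of_mem_reps {N : ℕ} [NeZero N] {x r : HGroup N} {k l : ℕ} (hlk : l ≤ k)
    (h : r ∈ reps x k l) : r ∈ cell x k := by
  classical
  obtain ⟨y, hy, rfl⟩ := Finset.mem_image.1 h
  exact cell_subset_of_mem hlk ((cell_finite x k).mem_toFinset.1 hy) (trunc_mem_cell l y)

theorem trunc_eq_self_of_mem_reps {N : ℕ} [NeZero N] {x r : HGroup N} {k l : ℕ}
    (h : r ∈ reps x k l) : trunc l r = r := by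
  classical
  obtain ⟨y, hy, rfl⟩ := Finset.mem_image.1 h
  exact trunc_eq_iff.2 (mem_cell_comm.1 (trunc_mem_cell l y))

theorem disjoint_cell_of_mem_reps {N : ℕ} [NeZero N] {x r s : HGroup N} {k l : ℕ}
    (hr : r ∈ reps x k l) (hs : s ∈ reps x k l) (hrs : r ≠ s) :
    Disjoint (cell r l) (cell s l) := by
  rw [Set.disjoint_left]
  intro y hy hy'
  refine hrs ?_
  rw [← trunc_eq_self_of_mem_reps hr, ← trunc_eq_self_of_mem_reps hs,
    trunc_eq_iff.2 hy, trunc_eq_iff.2 hy']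

theorem card_reps {N : ℕ} [NeZero N] (x : HGroup N) {k l : ℕ} (hlk : l ≤ k) :
    (reps x k l).card = N ^ (k - l) := by
  classical
  have hsum := Finset.card_eq_sum_card_fiberwise (f := trunc l)
    (s := (cell_finite x k).toFinset) (t := reps x k l)
    (fun y hy => trunc_mem_reps l (by simpa using hy))
  have hfib : ∀ r ∈ reps x k l,
      ((cell_finite x k).toFinset.filter fun y => trunc l y = r).card = N ^ l := by
    intro r hr
    have : ((cell_finite x k).toFinset.filter fun y => trunc l y = r) =
        (cell_finite r l).toFinset := by
      ext y
      rw [Finset.mem_filter, Set.Finite.mem_toFinset, Set.Finite.mem_toFinset]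
      constructor
      · rintro ⟨-, rfl⟩
        exact mem_cell_comm.1 (trunc_mem_cell l y)
      · intro hy
        refine ⟨cell_subset_of_mem hlk (mem_cell_of_mem_reps hlk hr) hy, ?_⟩
        rw [← trunc_eq_iff.2 hy, trunc_eq_self_of_mem_reps hr]
    rw [this, ← Set.ncard_eq_toFinset_card _ (cell_finite r l), cell_ncard]
  rw [Finset.sum_congr rfl hfib, Finset.sum_const, smul_eq_mul,
    ← Set.ncard_eq_toFinset_card _ (cell_finite x k), cell_ncard] at hsum
  have hpos : 0 < N ^ l := pow_pos (NeZero.pos N) l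
  have : N ^ (k - l) * N ^ l = N ^ k := by rw [← pow_add]; congr 1; omega
  exact Nat.eq_of_mul_eq_mul_right hpos (hsum.symm.trans this.symm)

/-! ### Clusters inside balls, majority clusters, and linked scales. -/

/-- `y` and `z` are connected within `b`. -/
def Conn {N : ℕ} (G : SimpleGraph (HGroup N)) (b : Set (HGroup N)) (y z : HGroup N) : Prop :=
  ∃ (hy : y ∈ b) (hz : z ∈ b), (G.induce b).Reachable ⟨y, hy⟩ ⟨z, hz⟩

namespace Conn

variable {N : ℕ} {G : SimpleGraph (HGroup N)} {b c : Set (HGroup N)} {x y z : HGroup N}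

theorem refl (h : y ∈ b) : Conn G b y y := ⟨h, h, SimpleGraph.Reachable.refl _⟩

theorem symm (h : Conn G b y z) : Conn G b z y :=
  let ⟨hy, hz, h⟩ := h
  ⟨hz, hy, h.symm⟩

theorem trans (h : Conn G b x y) (h' : Conn G b y z) : Conn G b x z :=
  let ⟨hx, _, h⟩ := h
  let ⟨_, hz, h'⟩ := h'
  ⟨hx, hz, h.trans h'⟩

theorem of_adj (hy : y ∈ b) (hz : z ∈ b) (h : G.Adj y z) : Conn G b y z :=
  ⟨hy, hz, SimpleGraph.Adj.reachable (by simpa using h)⟩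

theorem mono (hbc : b ⊆ c) (h : Conn G b y z) : Conn G c y z :=
  let ⟨hy, hz, h⟩ := h
  ⟨hbc hy, hbc hz, h.map (G.induceHomOfLE hbc).toHom⟩

theorem reachable (h : Conn G b y z) : G.Reachable y z :=
  let ⟨_, _, h⟩ := h
  h.map (SimpleGraph.Embedding.induce b).toHom

theorem right_mem (h : Conn G b y z) : z ∈ b := h.2.1

theorem congr {G' : SimpleGraph (HGroup N)}
    (h : ∀ y ∈ b, ∀ z ∈ b, (G.Adj y z ↔ G'.Adj y z)) : Conn G b = Conn G' b := by
  have : G.induce b = G'.induce b := by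
    ext u v
    exact h u u.2 v v.2
  funext y z
  simp only [Conn, this]

end Conn

/-- The cluster of `z` in the ball of radius `k` around `z`. -/
def cl {N : ℕ} (G : SimpleGraph (HGroup N)) (k : ℕ) (z : HGroup N) : Set (HGroup N) :=
  {w | Conn G (cell z k) z w}

/-- The cluster of `z` in the ball of radius `k` around `z` fills more than half of that ball. -/
def InMajority {N : ℕ} (G : SimpleGraph (HGroup N)) (k : ℕ) (z : HGroup N) : Prop :=
  N ^ k < 2 * (cl G k z).ncard

section

variable {N : ℕ} {G : SimpleGraph (HGroup N)} {k l : ℕ} {x y z : HGroup N}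

theorem self_mem_cl : z ∈ cl G k z := Conn.refl (mem_cell_self z k)

theorem cl_subset_cell : cl G k z ⊆ cell z k := fun _ h => h.right_mem

theorem mem_cl_of_cell (hy : y ∈ cell x k) (hz : Conn G (cell x k) y z) : z ∈ cl G k y := by
  rw [cl, Set.mem_ofPred_eq, cell_eq_of_mem hy]
  exact hz

theorem conn_of_mem_cl (hy : y ∈ cell x k) (hz : z ∈ cl G k y) : Conn G (cell x k) y z := by
  rw [← cell_eq_of_mem hy]
  exact hz

theorem cl_eq_of_mem (h : z ∈ cl G k y) : cl G k z = cl G k y := by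
  have hz : z ∈ cell y k := cl_subset_cell h
  ext w
  rw [cl, cl, cell_eq_of_mem hz]
  exact ⟨fun hw => Conn.trans h hw, fun hw => (Conn.symm h).trans hw⟩

theorem cl_mono (h : k ≤ l) : cl G k z ⊆ cl G l z := fun _ hw => Conn.mono (cell_mono z h) hw

theorem cl_finite [NeZero N] : (cl G k z).Finite := (cell_finite z k).subset cl_subset_cell

theorem InMajority.of_mem_cl (h : InMajority G k y) (hz : z ∈ cl G k y) : InMajority G k z := by
  rw [InMajority, cl_eq_of_mem hz]
  exact h

/-- Two sets that each fill more than half of a ball must meet. So a ball has at most one majority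
cluster, and no choice of it is ever needed. -/
theorem InMajority.mem_cl [NeZero N] (hy : InMajority G k y) (hz : InMajority G k z)
    (h : z ∈ cell y k) : z ∈ cl G k y := by
  by_contra hne
  have hdisj : Disjoint (cl G k y) (cl G k z) := by
    rw [Set.disjoint_left]
    intro w hw hw'
    refine hne ?_
    have e : cl G k z = cl G k y := (cl_eq_of_mem hw').symm.trans (cl_eq_of_mem hw)
    rw [← e]
    exact self_mem_cl
  have hle := Set.ncard_le_ncard (s := cl G k y ∪ cl G k z) (t := cell y k)
    (Set.union_subset cl_subset_cell (by rw [← cell_eq_of_mem h]; exact cl_subset_cell))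
    (cell_finite y k)
  rw [Set.ncard_union_eq hdisj cl_finite cl_finite, cell_ncard] at hle
  unfold InMajority at hy hz
  omega

/-- The majority clusters of the `l`-balls around `r` and `s` are joined by an edge, if they
exist. -/
def Joined (G : SimpleGraph (HGroup N)) (l : ℕ) (r s : HGroup N) : Prop :=
  ∀ y ∈ cell r l, ∀ z ∈ cell s l, InMajority G l y → InMajority G l z →
    ∃ y' ∈ cl G l y, ∃ z' ∈ cl G l z, G.Adj y' z'

theorem Joined.conn [NeZero N] {r s : HGroup N} (hlk : l ≤ k) (h : Joined G l r s)
    (hr : r ∈ cell x k) (hs : s ∈ cell x k)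
    (hy : y ∈ cell r l) (hz : z ∈ cell s l) (my : InMajority G l y) (mz : InMajority G l z) :
    Conn G (cell x k) y z := by
  obtain ⟨y', hy', z', hz', hadj⟩ := h y hy z hz my mz
  have hyx := cell_subset_of_mem hlk (cell_subset_of_mem hlk hr hy)
  have hzx := cell_subset_of_mem hlk (cell_subset_of_mem hlk hs hz)
  have c1 : Conn G (cell x k) y y' := Conn.mono hyx hy'
  have c2 : Conn G (cell x k) z z' := Conn.mono hzx hz'
  exact (c1.trans (Conn.of_adj c1.right_mem c2.right_mem hadj)).trans c2.symm

/-- Majority clusters of pairwise joined balls are part of one cluster. -/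
theorem card_mul_le_ncard_cl [NeZero N] (hlk : l ≤ k) (R : Finset (HGroup N))
    (hR : R ⊆ reps x k l) (f : HGroup N → HGroup N) (hf : ∀ r ∈ R, f r ∈ cell r l)
    (hmaj : ∀ r ∈ R, InMajority G l (f r))
    (hj : ∀ r ∈ R, ∀ s ∈ R, r ≠ s → Joined G l r s) {a : ℝ}
    (ha : ∀ r ∈ R, a ≤ (cl G l (f r)).ncard) {r₀ : HGroup N} (hr₀ : r₀ ∈ R) :
    R.card * a ≤ (cl G k (f r₀)).ncard := by
  classical
  have hmem : ∀ r ∈ R, r ∈ cell x k := fun r hr => mem_cell_of_mem_reps hlk (hR hr)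
  have hfx : ∀ r ∈ R, f r ∈ cell x k := fun r hr =>
    cell_subset_of_mem hlk (hmem r hr) (hf r hr)
  have hsub : ∀ r ∈ R, cl G l (f r) ⊆ cl G k (f r₀) := by
    intro r hr w hw
    have h1 : Conn G (cell x k) (f r) w := Conn.mono (cell_subset_of_mem hlk (hfx r hr)) hw
    refine mem_cl_of_cell (hfx r₀ hr₀) (Conn.trans ?_ h1)
    by_cases e : r₀ = r
    · subst e
      exact Conn.refl (hfx _ hr₀)
    · exact (hj r₀ hr₀ r hr e).conn hlk (hmem _ hr₀) (hmem _ hr) (hf _ hr₀) (hf _ hr)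
        (hmaj _ hr₀) (hmaj _ hr)
  let T : HGroup N → Finset (HGroup N) := fun r => (cl_finite (G := G) (k := l) (z := f r)).toFinset
  -- The clusters lie in different `l`-balls, so their sizes add up.
  have hdisj : (R : Set (HGroup N)).PairwiseDisjoint T := by
    intro r hr s hs hrs
    rw [Function.onFun, Finset.disjoint_left]
    intro w hw hw'
    have hw := cl_subset_cell ((Set.Finite.mem_toFinset _).1 hw)
    have hw' := cl_subset_cell ((Set.Finite.mem_toFinset _).1 hw')
    rw [cell_eq_of_mem (hf r hr)] at hw
    rw [cell_eq_of_mem (hf s hs)] at hw'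
    exact Set.disjoint_left.1 (disjoint_cell_of_mem_reps (hR hr) (hR hs) hrs) hw hw'
  have hcard := Finset.card_biUnion hdisj
  have hle : (R.biUnion T).card ≤ (cl G k (f r₀)).ncard := by
    rw [Set.ncard_eq_toFinset_card _ cl_finite]
    refine Finset.card_le_card ?_
    intro w hw
    obtain ⟨r, hr, hw⟩ := Finset.mem_biUnion.1 hw
    rw [Set.Finite.mem_toFinset] at hw ⊢
    exact hsub r hr hw
  have hsum : (R.card : ℝ) * a ≤ ∑ r ∈ R, ((T r).card : ℝ) := by
    rw [← nsmul_eq_mul]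
    refine Finset.card_nsmul_le_sum _ _ _ fun r hr => ?_
    rw [← Set.ncard_eq_toFinset_card _ cl_finite]
    exact ha r hr
  calc (R.card : ℝ) * a ≤ ∑ r ∈ R, ((T r).card : ℝ) := hsum
    _ = ((R.biUnion T).card : ℝ) := by rw [hcard]; push_cast; rfl
    _ ≤ _ := by exact_mod_cast hle

/-- All the `k`-balls in the `(k + 1)`-ball around the origin have majority clusters, and these
are joined to each other. -/
def Linked [NeZero N] (G : SimpleGraph (HGroup N)) (k : ℕ) : Prop :=
  (∀ r ∈ reps (0 : HGroup N) (k + 1) k, ∃ z ∈ cell r k, InMajority G k z) ∧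
    ∀ r ∈ reps (0 : HGroup N) (k + 1) k, ∀ s ∈ reps (0 : HGroup N) (k + 1) k, r ≠ s →
      Joined G k r s

theorem Linked.exists_inMajority [NeZero N] (h : Linked G k) (hx : x ∈ cell 0 (k + 1)) :
    ∃ z ∈ cell x k, InMajority G k z := by
  obtain ⟨z, hz, hm⟩ := h.1 _ (trunc_mem_reps k hx)
  rw [cell_eq_of_mem (trunc_mem_cell k x)] at hz
  exact ⟨z, hz, hm⟩

theorem Linked.conn [NeZero N] (h : Linked G k) (hy : y ∈ cell 0 (k + 1)) (hz : z ∈ cell 0 (k + 1))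
    (my : InMajority G k y) (mz : InMajority G k z) : Conn G (cell 0 (k + 1)) y z := by
  by_cases e : trunc k y = trunc k z
  · have := my.mem_cl mz (trunc_eq_iff.1 e)
    exact Conn.mono (cell_subset_of_mem (Nat.le_succ k) hy) this
  · have hy' := trunc_mem_reps k hy
    have hz' := trunc_mem_reps k hz
    exact (h.2 _ hy' _ hz' e).conn (Nat.le_succ k) (mem_cell_of_mem_reps (Nat.le_succ k) hy')
      (mem_cell_of_mem_reps (Nat.le_succ k) hz') (mem_cell_comm.1 (trunc_mem_cell k y))
      (mem_cell_comm.1 (trunc_mem_cell k z)) my mz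

/-- All `N` majority clusters merge, and each has more than half of its ball, so the union has more
than half of the `(k + 1)`-ball. No density is lost, which is why `Linked` demands all sub-balls and
not all but one. -/
theorem Linked.inMajority_succ [NeZero N] (h : Linked G k) (hy : y ∈ cell 0 (k + 1))
    (my : InMajority G k y) : InMajority G (k + 1) y := by
  choose! f hf hm using h.1
  set r₀ := trunc k y with hr₀
  have hr : r₀ ∈ reps (0 : HGroup N) (k + 1) k := trunc_mem_reps k hy
  have key := card_mul_le_ncard_cl (G := G) (Nat.le_succ k) _ (Finset.Subset.refl _) f hf hm h.2
    -- Integrality turns `N ^ k < 2 * card` into a lower bound with `+ 1`, which keeps the summed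
    -- inequality strict.
    (a := ((N ^ k + 1 : ℕ) : ℝ) / 2) (fun r hr => by
      have : N ^ k + 1 ≤ 2 * (cl G k (f r)).ncard := hm r hr
      have : ((N ^ k + 1 : ℕ) : ℝ) ≤ 2 * (cl G k (f r)).ncard := by exact_mod_cast this
      linarith) hr
  rw [card_reps _ (Nat.le_succ k)] at key
  have h2 : N * (N ^ k + 1) ≤ 2 * (cl G (k + 1) (f r₀)).ncard := by
    have : ((N * (N ^ k + 1) : ℕ) : ℝ) ≤ ((2 * (cl G (k + 1) (f r₀)).ncard : ℕ) : ℝ) := by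
      simp only [Nat.add_sub_cancel_left, pow_one, Nat.succ_eq_add_one] at key
      push_cast at key ⊢
      linarith
    exact_mod_cast this
  have hm' : InMajority G (k + 1) (f r₀) := by
    have := NeZero.pos N
    rw [InMajority, pow_succ']
    nlinarith
  have hf0 : f r₀ ∈ cell 0 (k + 1) :=
    cell_subset_of_mem (Nat.le_succ k) (mem_cell_of_mem_reps (Nat.le_succ k) hr) (hf _ hr)
  exact hm'.of_mem_cl (mem_cl_of_cell hf0 (h.conn hf0 hy (hm _ hr) my))

theorem Linked.inMajority_of_le [NeZero N] {m : ℕ} (h : ∀ k, m ≤ k → Linked G k)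
    (hy : y ∈ cell 0 m) (my : InMajority G m y) (hk : m ≤ k) : InMajority G k y := by
  induction k, hk using Nat.le_induction with
  | base => exact my
  | succ k hk ih => exact (h k hk).inMajority_succ (cell_mono 0 (by omega) hy) ih

end

end HierPerc

/-! ### Finitely determined events: measurability, independence, conditioning. -/

namespace HierPerc

instance (N : ℕ) : IsProbabilityMeasure (law N) := by
  unfold law
  infer_instance

/-- The probability that the random graph has the property `P`. -/
noncomputable def prob (N : ℕ) (δ : ℝ) (c : ℕ → ℝ) (P : SimpleGraph (HGroup N) → Prop) : ENNReal :=
  law N {U | P (graph N δ c U)}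

/-- The property `P` of graphs depends only on the adjacency of the pairs in `T`. -/
def LocalOn {N : ℕ} (T : Set (HGroup N × HGroup N)) (P : SimpleGraph (HGroup N) → Prop) : Prop :=
  ∀ G G' : SimpleGraph (HGroup N), (∀ p ∈ T, (G.Adj p.1 p.2 ↔ G'.Adj p.1 p.2)) → (P G → P G')

/-- The unordered pairs that underlie a set of ordered pairs. -/
def edgeSet {N : ℕ} (T : Set (HGroup N × HGroup N)) : Set (Sym2 (HGroup N)) :=
  (fun p => s(p.1, p.2)) '' T

/-- The σ-algebra generated by the uniform variables of the pairs in `E`. -/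
@[reducible] def edgeSigma {N : ℕ} (E : Set (Sym2 (HGroup N))) : MeasurableSpace (Sample N) :=
  ⨆ e ∈ E, MeasurableSpace.comap (fun U : Sample N => U e) inferInstance

theorem edgeSigma_le {N : ℕ} (E : Set (Sym2 (HGroup N))) :
    edgeSigma E ≤ (inferInstance : MeasurableSpace (Sample N)) :=
  iSup₂_le fun e _ => (measurable_pi_apply e).comap_le

theorem graph_adj {N : ℕ} {δ : ℝ} {c : ℕ → ℝ} {U : Sample N} {x y : HGroup N} :
    (graph N δ c U).Adj x y ↔
      x ≠ y ∧ ((U s(x, y) : unitInterval) : ℝ) ≤ connProb N δ c (hdist x y) := by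
  rw [graph, SimpleGraph.fromRel_adj, hdist_comm y x, Sym2.eq_swap (a := y), or_self]

theorem measurableSet_adj {N : ℕ} (δ : ℝ) (c : ℕ → ℝ) {E : Set (Sym2 (HGroup N))} {x y : HGroup N}
    (h : s(x, y) ∈ E) : MeasurableSet[edgeSigma E] {U | (graph N δ c U).Adj x y} := by
  have hle : MeasurableSpace.comap (fun U : Sample N => U s(x, y)) inferInstance ≤ edgeSigma E :=
    le_iSup₂_of_le s(x, y) h le_rfl
  refine hle _ ?_
  refine ⟨{u : unitInterval | x ≠ y ∧ (u : ℝ) ≤ connProb N δ c (hdist x y)}, ?_, ?_⟩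
  · exact (MeasurableSet.const _).inter (measurableSet_le measurable_subtype_coe measurable_const)
  · ext U
    exact graph_adj.symm

namespace LocalOn

variable {N : ℕ} {T T' : Set (HGroup N × HGroup N)} {P Q : SimpleGraph (HGroup N) → Prop}

theorem mono (h : LocalOn T P) (hT : T ⊆ T') : LocalOn T' P :=
  fun G G' hG => h G G' fun p hp => hG p (hT hp)

theorem not (h : LocalOn T P) : LocalOn T fun G => ¬ P G :=
  fun G G' hG hn hP => hn (h G' G (fun p hp => (hG p hp).symm) hP)

theorem and (h : LocalOn T P) (h' : LocalOn T Q) : LocalOn T fun G => P G ∧ Q G :=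
  fun G G' hG hP => ⟨h G G' hG hP.1, h' G G' hG hP.2⟩

theorem all {ι : Sort*} {P : ι → SimpleGraph (HGroup N) → Prop} (h : ∀ i, LocalOn T (P i)) :
    LocalOn T fun G => ∀ i, P i G :=
  fun G G' hG hP i => h i G G' hG (hP i)

/-- A property that is a function of a quantity determined by `T`. -/
theorem of_eq {α : Type*} (f : SimpleGraph (HGroup N) → α)
    (h : ∀ G G', (∀ p ∈ T, (G.Adj p.1 p.2 ↔ G'.Adj p.1 p.2)) → f G = f G') (P : α → Prop) :
    LocalOn T fun G => P (f G) :=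
  by
  intro G G' hG hP
  simpa only [h G G' hG] using hP

/-- The event is a preimage under the map to finitely many adjacencies, whose target is finite and
discrete. -/
theorem measurableSet_edgeSigma (h : LocalOn T P) (hT : T.Finite) (δ : ℝ) (c : ℕ → ℝ) :
    MeasurableSet[edgeSigma (edgeSet T)] {U | P (graph N δ c U)} := by
  have := hT.to_subtype
  let f : Sample N → (T → Prop) := fun U p => (graph N δ c U).Adj p.1.1 p.1.2
  have hf : @Measurable _ _ (edgeSigma (edgeSet T)) _ f := by
    rw [@measurable_pi_iff]
    intro p
    have hp : s(p.1.1, p.1.2) ∈ edgeSet T := Set.mem_image_of_mem _ p.2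
    exact (@measurableSet_setOfPred _ (edgeSigma (edgeSet T)) _).1 (measurableSet_adj δ c hp)
  have hpre : {U | P (graph N δ c U)} = f ⁻¹' (f '' {U | P (graph N δ c U)}) := by
    refine Set.Subset.antisymm (Set.subset_preimage_image _ _) ?_
    rintro U ⟨U', hU', he⟩
    refine h _ _ (fun p hp => ?_) hU'
    exact iff_of_eq (congrFun he ⟨p, hp⟩)
  rw [hpre]
  exact hf (Set.toFinite _).measurableSet

theorem measurableSet (h : LocalOn T P) (hT : T.Finite) (δ : ℝ) (c : ℕ → ℝ) :
    MeasurableSet {U | P (graph N δ c U)} :=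
  edgeSigma_le _ _ (h.measurableSet_edgeSigma hT δ c)

end LocalOn

variable {N : ℕ} {δ : ℝ} {c : ℕ → ℝ}

theorem prob_mono {P Q : SimpleGraph (HGroup N) → Prop} (h : ∀ G, P G → Q G) :
    prob N δ c P ≤ prob N δ c Q :=
  measure_mono fun _ hU => h _ hU

theorem prob_or_le (P Q : SimpleGraph (HGroup N) → Prop) :
    prob N δ c (fun G => P G ∨ Q G) ≤ prob N δ c P + prob N δ c Q :=
  measure_union_le _ _

theorem prob_exists_mem_le {ι : Type*} (I : Finset ι) (P : ι → SimpleGraph (HGroup N) → Prop) :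
    prob N δ c (fun G => ∃ i ∈ I, P i G) ≤ ∑ i ∈ I, prob N δ c (P i) := by
  refine (measure_mono fun U hU => ?_).trans (measure_biUnion_finset_le I _)
  obtain ⟨i, hi, h⟩ := hU
  exact Set.mem_biUnion hi h

theorem prob_exists_mem_le_mul {ι : Type*} (I : Finset ι) (P : ι → SimpleGraph (HGroup N) → Prop)
    {q : ENNReal} (h : ∀ i ∈ I, prob N δ c (P i) ≤ q) :
    prob N δ c (fun G => ∃ i ∈ I, P i G) ≤ I.card * q := by
  refine (prob_exists_mem_le I P).trans ((Finset.sum_le_sum h).trans ?_)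
  rw [Finset.sum_const, nsmul_eq_mul]

theorem prob_and {T T' : Set (HGroup N × HGroup N)} {P Q : SimpleGraph (HGroup N) → Prop}
    (hP : LocalOn T P) (hT : T.Finite) (hQ : LocalOn T' Q) (hT' : T'.Finite)
    (hd : Disjoint (edgeSet T) (edgeSet T')) :
    prob N δ c (fun G => P G ∧ Q G) = prob N δ c P * prob N δ c Q := by
  have hi : ProbabilityTheory.iIndepFun (fun (e : Sym2 (HGroup N)) (U : Sample N) => U e) (law N) :=
    ProbabilityTheory.iIndepFun_infinitePi (X := fun _ u => u) fun _ => measurable_id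
  have h := ProbabilityTheory.indep_iSup_of_disjoint
    (fun e => (measurable_pi_apply (X := fun _ : Sym2 (HGroup N) => unitInterval) e).comap_le) hi hd
  exact (ProbabilityTheory.Indep_iff _ _ _).1 h _ _ (hP.measurableSet_edgeSigma hT δ c)
    (hQ.measurableSet_edgeSigma hT' δ c)

/-- There is no edge between `S` and `T`. -/
def NoEdge (S T : Set (HGroup N)) (G : SimpleGraph (HGroup N)) : Prop :=
  ∀ y ∈ S, ∀ z ∈ T, ¬ G.Adj y z

theorem NoEdge.localOn (S T : Set (HGroup N)) : LocalOn (S ×ˢ T) (NoEdge S T) := by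
  intro G G' hG h y hy z hz hadj
  exact h y hy z hz ((hG (y, z) ⟨hy, hz⟩).2 hadj)

theorem connProb_le_one (k : ℕ) : connProb N δ c k ≤ 1 := min_le_right _ _

theorem volume_lt_connProb (k : ℕ) :
    (volume : Measure unitInterval) {u | ¬ (u : ℝ) ≤ connProb N δ c k} =
      1 - ENNReal.ofReal (connProb N δ c k) := by
  have hm : MeasurableSet {u : unitInterval | (u : ℝ) ≤ connProb N δ c k} :=
    measurableSet_le measurable_subtype_coe measurable_const
  have hc : {u : unitInterval | ¬ (u : ℝ) ≤ connProb N δ c k} =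
      {u : unitInterval | (u : ℝ) ≤ connProb N δ c k}ᶜ := rfl
  rw [hc, prob_compl_eq_one_sub hm]
  congr 1
  by_cases h0 : 0 ≤ connProb N δ c k
  · have : {u : unitInterval | (u : ℝ) ≤ connProb N δ c k} =
        Set.Iic ⟨connProb N δ c k, h0, connProb_le_one k⟩ := rfl
    rw [this, unitInterval.volume_Iic]
  · have : {u : unitInterval | (u : ℝ) ≤ connProb N δ c k} = ∅ := by
      ext u
      have := u.2.1
      simp only [Set.mem_ofPred_eq, Set.mem_empty_iff_false, iff_false]
      linarith
    rw [this, measure_empty, ENNReal.ofReal_of_nonpos (by linarith)]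

theorem prob_adj_le (x y : HGroup N) :
    prob N δ c (fun G => G.Adj x y) ≤ ENNReal.ofReal (connProb N δ c (hdist x y)) := by
  classical
  have hm : MeasurableSet {u : unitInterval | (u : ℝ) ≤ connProb N δ c (hdist x y)} :=
    measurableSet_le measurable_subtype_coe measurable_const
  have hsub : {U : Sample N | (graph N δ c U).Adj x y} ⊆ (fun U : Sample N => U s(x, y)) ⁻¹'
      {u : unitInterval | (u : ℝ) ≤ connProb N δ c (hdist x y)} := by
    intro U hU
    exact (graph_adj.1 hU).2
  have hmp : MeasurePreserving (fun U : Sample N => U s(x, y)) (law N) volume :=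
    measurePreserving_eval_infinitePi _ s(x, y)
  refine (measure_mono hsub).trans ?_
  rw [hmp.measure_preimage hm.nullMeasurableSet]
  have h := volume_lt_connProb (N := N) (δ := δ) (c := c) (hdist x y)
  have hc : {u : unitInterval | ¬ (u : ℝ) ≤ connProb N δ c (hdist x y)} =
      {u : unitInterval | (u : ℝ) ≤ connProb N δ c (hdist x y)}ᶜ := rfl
  rw [hc, prob_compl_eq_one_sub hm] at h
  have hp : ENNReal.ofReal (connProb N δ c (hdist x y)) ≤ 1 := by
    rw [ENNReal.ofReal_le_one]; exact connProb_le_one _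
  rw [← ENNReal.sub_sub_cancel ENNReal.one_ne_top MeasureTheory.prob_le_one, h,
    ENNReal.sub_sub_cancel ENNReal.one_ne_top hp]

/-- As `S` and `T` are disjoint, different ordered pairs have different unordered pairs, so the
event is a box in the product space. -/
theorem prob_noEdge (S T : Finset (HGroup N)) (hd : Disjoint S T) :
    prob N δ c (NoEdge S T) =
      ∏ p ∈ S ×ˢ T, (1 - ENNReal.ofReal (connProb N δ c (hdist p.1 p.2))) := by
  classical
  let f : Sym2 (HGroup N) → ℕ := Sym2.lift ⟨hdist, hdist_comm⟩
  have hinj : Set.InjOn (fun p : HGroup N × HGroup N => s(p.1, p.2)) (S ×ˢ T : Finset _) := by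
    rintro ⟨a, b⟩ h ⟨a', b'⟩ h' he
    rw [Finset.mem_coe, Finset.mem_product] at h h'
    rcases Sym2.eq_iff.1 he with ⟨h1, h2⟩ | ⟨h1, h2⟩
    · exact Prod.ext h1 h2
    · exact absurd h'.2 (Finset.disjoint_left.1 hd (h1 ▸ h.1))
  have hset : {U | NoEdge (S : Set (HGroup N)) T (graph N δ c U)} =
      Set.pi ((S ×ˢ T).image fun p => s(p.1, p.2) : Finset _)
        fun e => {u : unitInterval | ¬ (u : ℝ) ≤ connProb N δ c (f e)} := by
    ext U
    simp only [NoEdge, Set.mem_ofPred_eq, Set.mem_pi, Finset.mem_coe, Finset.mem_image,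
      Finset.mem_product, forall_exists_index, and_imp, Prod.forall]
    constructor
    · rintro h e a b ha hb rfl hle
      exact h a ha b hb (graph_adj.2 ⟨fun e => Finset.disjoint_left.1 hd ha (e ▸ hb), hle⟩)
    · intro h a ha b hb hadj
      exact h _ a b ha hb rfl (graph_adj.1 hadj).2
  rw [prob, hset, law, Measure.infinitePi_pi, Finset.prod_image hinj]
  · exact Finset.prod_congr rfl fun p _ => volume_lt_connProb _
  · intro e _
    exact (measurableSet_le measurable_subtype_coe measurable_const).compl

/-- A bound that holds conditionally on each of several disjoint independent events. -/
theorem prob_exists_and_le {ι : Type*} (I : Finset ι) {T T' : Set (HGroup N × HGroup N)}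
    {A B : ι → SimpleGraph (HGroup N) → Prop} (hA : ∀ i ∈ I, LocalOn T (A i)) (hT : T.Finite)
    (hB : ∀ i ∈ I, LocalOn T' (B i)) (hT' : T'.Finite) (hd : Disjoint (edgeSet T) (edgeSet T'))
    (hAd : ∀ G, ∀ i ∈ I, ∀ j ∈ I, A i G → A j G → i = j) {q : ENNReal}
    (hq : ∀ i ∈ I, prob N δ c (B i) ≤ q) :
    prob N δ c (fun G => ∃ i ∈ I, A i G ∧ B i G) ≤ q := by
  refine (prob_exists_mem_le I _).trans ?_
  have h1 : ∑ i ∈ I, prob N δ c (fun G => A i G ∧ B i G) ≤ ∑ i ∈ I, prob N δ c (A i) * q := by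
    refine Finset.sum_le_sum fun i hi => ?_
    rw [prob_and (hA i hi) hT (hB i hi) hT' hd]
    exact mul_le_mul_right (hq i hi) _
  refine h1.trans ?_
  rw [← Finset.sum_mul]
  refine mul_le_of_le_one_left zero_le ?_
  have h2 := measure_biUnion_finset (μ := law N) (s := I)
    (f := fun i => {U | A i (graph N δ c U)})
    (fun i hi j hj hij => Set.disjoint_left.2 fun U hU hU' => hij (hAd _ i hi j hj hU hU'))
    (fun i hi => (hA i hi).measurableSet hT δ c)
  exact h2.symm.le.trans MeasureTheory.prob_le_one

/-- A comparison that holds conditionally on each of several disjoint independent events. -/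
theorem prob_exists_and_le_prob {ι : Type*} (I : Finset ι) {T T' : Set (HGroup N × HGroup N)}
    {A B B' : ι → SimpleGraph (HGroup N) → Prop} (hA : ∀ i ∈ I, LocalOn T (A i)) (hT : T.Finite)
    (hB : ∀ i ∈ I, LocalOn T' (B i)) (hB' : ∀ i ∈ I, LocalOn T' (B' i)) (hT' : T'.Finite)
    (hd : Disjoint (edgeSet T) (edgeSet T'))
    (hAd : ∀ G, ∀ i ∈ I, ∀ j ∈ I, A i G → A j G → i = j)
    (hq : ∀ i ∈ I, prob N δ c (B i) ≤ prob N δ c (B' i)) :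
    prob N δ c (fun G => ∃ i ∈ I, A i G ∧ B i G) ≤
      prob N δ c (fun G => ∃ i ∈ I, A i G ∧ B' i G) := by
  refine (prob_exists_mem_le I _).trans ?_
  have h2 := measure_biUnion_finset (μ := law N) (s := I)
    (f := fun i => {U | A i (graph N δ c U) ∧ B' i (graph N δ c U)})
    (fun i hi j hj hij => Set.disjoint_left.2 fun U hU hU' => hij (hAd _ i hi j hj hU.1 hU'.1))
    (fun i hi => ((hA i hi).measurableSet hT δ c).inter ((hB' i hi).measurableSet hT' δ c))
  calc ∑ i ∈ I, prob N δ c (fun G => A i G ∧ B i G)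
      ≤ ∑ i ∈ I, prob N δ c (fun G => A i G ∧ B' i G) := by
        refine Finset.sum_le_sum fun i hi => ?_
        rw [prob_and (hA i hi) hT (hB i hi) hT' hd, prob_and (hA i hi) hT (hB' i hi) hT' hd]
        exact mul_le_mul_right (hq i hi) _
    _ = law N (⋃ i ∈ I, {U | A i (graph N δ c U) ∧ B' i (graph N δ c U)}) := h2.symm
    _ ≤ _ := measure_mono fun U hU => by
        obtain ⟨i, hi, h⟩ := Set.mem_iUnion₂.1 hU
        exact ⟨i, hi, h⟩

end HierPerc

/-! ### Joining majority clusters, and one renormalization step. -/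

namespace HierPerc

section

variable {N : ℕ} {δ : ℝ} {c : ℕ → ℝ}

theorem disjoint_edgeSet_of_hdist {T T' : Set (HGroup N × HGroup N)} {l : ℕ}
    (h : ∀ p ∈ T, hdist p.1 p.2 ≤ l) (h' : ∀ p ∈ T', l < hdist p.1 p.2) :
    Disjoint (edgeSet T) (edgeSet T') := by
  rw [Set.disjoint_left]
  rintro _ ⟨p, hp, rfl⟩ ⟨p', hp', he⟩
  have h1 := h p hp
  have h2 := h' p' hp'
  rcases Sym2.eq_iff.1 he with ⟨e1, e2⟩ | ⟨e1, e2⟩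
  · rw [e1, e2] at h2; omega
  · rw [e1, e2, hdist_comm] at h2; omega

theorem disjoint_edgeSet_of_disjoint {b b' : Set (HGroup N)} (h : Disjoint b b') :
    Disjoint (edgeSet (b ×ˢ b)) (edgeSet (b' ×ˢ b')) := by
  rw [Set.disjoint_left]
  rintro _ ⟨p, hp, rfl⟩ ⟨p', hp', he⟩
  rcases Sym2.eq_iff.1 he with ⟨e1, -⟩ | ⟨e1, -⟩
  · exact Set.disjoint_left.1 h hp.1 (e1 ▸ hp'.1)
  · exact Set.disjoint_left.1 h hp.2 (e1 ▸ hp'.1)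

theorem cl_congr {k : ℕ} {x z : HGroup N} (hz : z ∈ cell x k) {G G' : SimpleGraph (HGroup N)}
    (h : ∀ p ∈ cell x k ×ˢ cell x k, (G.Adj p.1 p.2 ↔ G'.Adj p.1 p.2)) :
    cl G k z = cl G' k z := by
  have : Conn G (cell x k) = Conn G' (cell x k) :=
    Conn.congr fun y hy w hw => h (y, w) ⟨hy, hw⟩
  rw [cl, cl, cell_eq_of_mem hz, this]

/-- The ball of radius `k` around `x` has a cluster of at least `a` points. -/
def HasCluster (x : HGroup N) (k : ℕ) (a : ℝ) (G : SimpleGraph (HGroup N)) : Prop :=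
  ∃ z ∈ cell x k, a ≤ (cl G k z).ncard

theorem HasCluster.localOn (x : HGroup N) (k : ℕ) (a : ℝ) :
    LocalOn (cell x k ×ˢ cell x k) (HasCluster x k a) := by
  rintro G G' hG ⟨z, hz, h⟩
  exact ⟨z, hz, cl_congr hz hG ▸ h⟩

theorem prob_noEdge_le [NeZero N] {S T : Set (HGroup N)} (hS : S.Finite) (hT : T.Finite)
    (hd : Disjoint S T) {p : ℝ}
    (hp : ∀ y ∈ S, ∀ z ∈ T, p ≤ connProb N δ c (hdist y z)) :
    prob N δ c (NoEdge S T) ≤ ENNReal.ofReal (Real.exp (-(p * (S.ncard * T.ncard)))) := by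
  classical
  lift S to Finset (HGroup N) using hS
  lift T to Finset (HGroup N) using hT
  rw [prob_noEdge S T (Finset.disjoint_coe.1 hd), Set.ncard_coe_finset, Set.ncard_coe_finset]
  have h1 : ∀ q ∈ S ×ˢ T, 1 - ENNReal.ofReal (connProb N δ c (hdist q.1 q.2)) ≤
      ENNReal.ofReal (Real.exp (-p)) := by
    intro q hq
    rw [Finset.mem_product] at hq
    refine tsub_le_iff_right.2 ?_
    refine le_trans ?_ (add_le_add_right
      (ENNReal.ofReal_le_ofReal (hp q.1 hq.1 q.2 hq.2)) _)
    by_cases h0 : 0 ≤ p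
    · rw [← ENNReal.ofReal_add (Real.exp_pos _).le h0, ← ENNReal.ofReal_one]
      refine ENNReal.ofReal_le_ofReal ?_
      have := Real.add_one_le_exp (-p)
      linarith
    -- For negative `p` the truncation in `ofReal` loses `p`, but then `exp (-p)` alone is at least
    -- `1`.
    · refine le_add_of_le_left ?_
      rw [← ENNReal.ofReal_one]
      exact ENNReal.ofReal_le_ofReal (Real.one_le_exp (by linarith))
  refine (Finset.prod_le_pow_card _ _ _ h1).trans ?_
  rw [← ENNReal.ofReal_pow (Real.exp_pos _).le, ← Real.exp_nat_mul, Finset.card_product]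
  refine ENNReal.ofReal_le_ofReal (le_of_eq ?_)
  congr 1
  push_cast
  ring

/-- Condition on the two majority clusters. They depend only on edges inside the two balls, whereas
the edges between the balls are at distance more than `l` and hence independent of them. At least `N
^ (2 * l) / 4` pairs are then available. -/
theorem prob_not_joined_le [NeZero N] {l : ℕ} {r s : HGroup N}
    (hd : Disjoint (cell r l) (cell s l)) {p : ℝ} (h0 : 0 ≤ p)
    (hp : ∀ y ∈ cell r l, ∀ z ∈ cell s l, p ≤ connProb N δ c (hdist y z)) :
    prob N δ c (fun G => ¬ Joined G l r s) ≤
      ENNReal.ofReal (Real.exp (-(p * ((N : ℝ) ^ (2 * l) / 4)))) := by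
  classical
  let I : Finset (Finset (HGroup N) × Finset (HGroup N)) :=
    ((cell_finite r l).toFinset.powerset ×ˢ (cell_finite s l).toFinset.powerset).filter
      fun q => N ^ l < 2 * q.1.card ∧ N ^ l < 2 * q.2.card
  let M : HGroup N → Finset (HGroup N) → SimpleGraph (HGroup N) → Prop := fun r C G =>
    ∃ y ∈ cell r l, InMajority G l y ∧ cl G l y = C
  have hMloc : ∀ r C, LocalOn (cell r l ×ˢ cell r l) (M r C) := by
    rintro r C G G' hG ⟨y, hy, hm, he⟩
    have e := cl_congr hy hG
    refine ⟨y, hy, ?_, e ▸ he⟩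
    unfold InMajority at hm ⊢
    rwa [← e]
  have hMun : ∀ r C C' G, M r C G → M r C' G → C = C' := by
    rintro r C C' G ⟨y, hy, hm, he⟩ ⟨y', hy', hm', he'⟩
    have : y' ∈ cl G l y := hm.mem_cl hm' (by rw [cell_eq_of_mem hy]; exact hy')
    rw [cl_eq_of_mem this, he] at he'
    exact_mod_cast he'
  have hsub : prob N δ c (fun G => ¬ Joined G l r s) ≤ prob N δ c
      (fun G => ∃ q ∈ I, (M r q.1 G ∧ M s q.2 G) ∧ NoEdge (q.1 : Set (HGroup N)) q.2 G) := by
    refine prob_mono fun G hG => ?_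
    unfold Joined at hG
    push Not at hG
    obtain ⟨y, hy, z, hz, my, mz, hno⟩ := hG
    refine ⟨((cl_finite (G := G) (k := l) (z := y)).toFinset,
      (cl_finite (G := G) (k := l) (z := z)).toFinset), ?_, ⟨⟨y, hy, my, by simp⟩,
      ⟨z, hz, mz, by simp⟩⟩, ?_⟩
    · have e1 := cell_eq_of_mem hy
      have e2 := cell_eq_of_mem hz
      rw [Finset.mem_filter, Finset.mem_product, Finset.mem_powerset, Finset.mem_powerset,
        Set.Finite.toFinset_subset_toFinset, Set.Finite.toFinset_subset_toFinset,
        ← Set.ncard_eq_toFinset_card _ cl_finite, ← Set.ncard_eq_toFinset_card _ cl_finite]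
      exact ⟨⟨e1 ▸ cl_subset_cell, e2 ▸ cl_subset_cell⟩, my, mz⟩
    · intro y' hy' z' hz'
      exact hno y' (by simpa using hy') z' (by simpa using hz')
  refine hsub.trans ?_
  have hI : ∀ q ∈ I, (q.1 : Set (HGroup N)) ⊆ cell r l ∧ (q.2 : Set (HGroup N)) ⊆ cell s l ∧
      N ^ l < 2 * q.1.card ∧ N ^ l < 2 * q.2.card := by
    intro q hq
    rw [Finset.mem_filter, Finset.mem_product, Finset.mem_powerset, Finset.mem_powerset,
      Set.Finite.subset_toFinset, Set.Finite.subset_toFinset] at hq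
    exact ⟨hq.1.1, hq.1.2, hq.2⟩
  refine prob_exists_and_le I
    (T := (cell r l ×ˢ cell r l) ∪ (cell s l ×ˢ cell s l)) (T' := cell r l ×ˢ cell s l)
    (fun q _ => ((hMloc r q.1).mono Set.subset_union_left).and
      ((hMloc s q.2).mono Set.subset_union_right))
    (((cell_finite r l).prod (cell_finite r l)).union ((cell_finite s l).prod (cell_finite s l)))
    (fun q hq => (NoEdge.localOn _ _).mono (Set.prod_mono (hI q hq).1 (hI q hq).2.1))
    ((cell_finite r l).prod (cell_finite s l))
    (disjoint_edgeSet_of_hdist (l := l) ?_ ?_)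
    (fun G q _ q' _ h h' => Prod.ext (hMun _ _ _ _ h.1 h'.1) (hMun _ _ _ _ h.2 h'.2)) ?_
  · rintro p (h | h)
    · exact hdist_le_trans (mem_cell_comm.1 h.1) h.2
    · exact hdist_le_trans (mem_cell_comm.1 h.1) h.2
  · rintro p h
    by_contra hle
    exact Set.disjoint_left.1 hd (hdist_le_trans h.1 (not_lt.1 hle)) h.2
  · intro q hq
    obtain ⟨h1, h2, h3, h4⟩ := hI q hq
    refine (prob_noEdge_le q.1.finite_toSet q.2.finite_toSet (hd.mono h1 h2)
      fun y hy z hz => hp y (h1 hy) z (h2 hz)).trans ?_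
    refine ENNReal.ofReal_le_ofReal (Real.exp_le_exp.2 (neg_le_neg ?_))
    refine mul_le_mul_of_nonneg_left ?_ h0
    rw [Set.ncard_coe_finset, Set.ncard_coe_finset]
    have h3' : (N : ℝ) ^ l ≤ 2 * q.1.card := by exact_mod_cast h3.le
    have h4' : (N : ℝ) ^ l ≤ 2 * q.2.card := by exact_mod_cast h4.le
    have := mul_le_mul h3' h4' (by positivity) (by positivity)
    rw [two_mul l, pow_add]
    linarith

/-- One scale step: a large cluster in all but at most one of the `l`-balls gives a large cluster
in the `k`-ball. -/
theorem prob_not_hasCluster_le [NeZero N] {k l : ℕ} (hlk : l ≤ k) (hM : 2 ≤ N ^ (k - l)) {a : ℝ}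
    (ha : (N : ℝ) ^ l < 2 * a) (x : HGroup N) {ε q : ENNReal}
    (hε : ∀ r ∈ reps x k l, prob N δ c (fun G => ¬ HasCluster r l a G) ≤ ε)
    (hq : ∀ r ∈ reps x k l, ∀ s ∈ reps x k l, r ≠ s →
      prob N δ c (fun G => ¬ Joined G l r s) ≤ q) :
    prob N δ c (fun G => ¬ HasCluster x k (((N : ℝ) ^ (k - l) - 1) * a) G) ≤
      ((N ^ (k - l) * N ^ (k - l) : ℕ) : ENNReal) * (ε ^ 2 + q) := by
  classical
  set R := reps x k l with hR
  have hcard : R.card = N ^ (k - l) := card_reps x hlk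
  have hsub : prob N δ c (fun G => ¬ HasCluster x k (((N : ℝ) ^ (k - l) - 1) * a) G) ≤
      prob N δ c (fun G => ∃ p ∈ R.offDiag, (¬ HasCluster p.1 l a G ∧ ¬ HasCluster p.2 l a G) ∨
        ¬ Joined G l p.1 p.2) := by
    refine prob_mono fun G hG => ?_
    by_contra hno
    push Not at hno
    refine hG ?_
    let B := R.filter fun r => HasCluster r l a G
    -- Two bad balls would form a pair excluded by `hno`, so at most one ball is bad.
    have hB : N ^ (k - l) ≤ B.card + 1 := by
      have hle : (R.filter fun r => ¬ HasCluster r l a G).card ≤ 1 := by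
        rw [Finset.card_le_one]
        intro r hr s hs
        rw [Finset.mem_filter] at hr hs
        by_contra hrs
        exact hs.2 ((hno (r, s) (Finset.mem_offDiag.2 ⟨hr.1, hs.1, hrs⟩)).1 hr.2)
      have := R.card_filter_add_card_filter_not fun r => HasCluster r l a G
      change B.card + _ = _ at this
      omega
    have hex : ∀ r ∈ B, ∃ z ∈ cell r l, a ≤ (cl G l z).ncard := fun r hr =>
      (Finset.mem_filter.1 hr).2
    choose! f hf hfa using hex
    obtain ⟨r₀, hr₀⟩ : B.Nonempty := by
      rw [← Finset.card_pos]; omega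
    have hBR : B ⊆ R := Finset.filter_subset _ _
    refine ⟨f r₀, cell_subset_of_mem hlk (mem_cell_of_mem_reps hlk (hBR hr₀)) (hf r₀ hr₀), ?_⟩
    refine le_trans ?_ (card_mul_le_ncard_cl hlk B hBR f hf (fun r hr => ?_) ?_ hfa hr₀)
    · have h1 : ((N ^ (k - l) : ℕ) : ℝ) ≤ ((B.card + 1 : ℕ) : ℝ) := by exact_mod_cast hB
      push_cast at h1
      refine mul_le_mul_of_nonneg_right (by linarith) ?_
      have : (0 : ℝ) ≤ (N : ℝ) ^ l := by positivity
      linarith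
    · have := hfa r hr
      have h2 : (N : ℝ) ^ l < 2 * (cl G l (f r)).ncard := by linarith
      unfold InMajority
      exact_mod_cast h2
    · intro r hr s hs hrs
      exact (hno (r, s) (Finset.mem_offDiag.2 ⟨hBR hr, hBR hs, hrs⟩)).2
  refine hsub.trans ((prob_exists_mem_le_mul _ _ (q := ε ^ 2 + q) ?_).trans ?_)
  · intro p hp
    rw [Finset.mem_offDiag] at hp
    refine (prob_or_le _ _).trans (add_le_add ?_ (hq _ hp.1 _ hp.2.1 hp.2.2))
    -- The two failures use edges inside disjoint balls, hence the square of `ε`.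
    rw [prob_and (HasCluster.localOn _ _ _).not ((cell_finite _ _).prod (cell_finite _ _))
      (HasCluster.localOn _ _ _).not ((cell_finite _ _).prod (cell_finite _ _))
      (disjoint_edgeSet_of_disjoint (disjoint_cell_of_mem_reps hp.1 hp.2.1 hp.2.2)), sq]
    exact mul_le_mul' (hε _ hp.1) (hε _ hp.2.1)
  · refine mul_le_mul_left ?_ _
    rw [Nat.cast_le, Finset.offDiag_card, hcard]
    exact Nat.sub_le _ _

theorem le_connProb [NeZero N] (hδ : -1 < δ) {k : ℕ} (hc : ∀ j, 1 ≤ j → 1 ≤ c j) {j : ℕ}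
    (hj : 1 ≤ j) (hjk : j ≤ k) : (N : ℝ) ^ (-((1 + δ) * k)) ≤ connProb N δ c j := by
  have hN : (1 : ℝ) ≤ N := by exact_mod_cast NeZero.pos N
  have hN0 : (0 : ℝ) < N := by linarith
  refine le_min ?_ (Real.rpow_le_one_of_one_le_of_nonpos hN ?_)
  · rw [le_div_iff₀ (Real.rpow_pos_of_pos hN0 _), ← Real.rpow_add hN0]
    refine (Real.rpow_le_one_of_one_le_of_nonpos hN ?_).trans (hc j hj)
    have : (j : ℝ) ≤ k := by exact_mod_cast hjk
    nlinarith
  · have : (0 : ℝ) ≤ (1 + δ) * k := by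
      have : 0 ≤ 1 + δ := by linarith
      positivity
    linarith

/-- Up to distance `K` the connection probability is `1`, and the uniform variables never exceed
`1`; the edges are thus present for every sample, not merely almost surely. This starts the
induction over scales. -/
theorem graph_adj_of_hdist_le [NeZero N] (hδ : -1 < δ) {K : ℕ}
    (hc : ∀ j, 1 ≤ j → (N : ℝ) ^ ((1 + δ) * K) ≤ c j) (U : Sample N) {x y : HGroup N}
    (hne : x ≠ y) (h : hdist x y ≤ K) : (graph N δ c U).Adj x y := by
  have hN : (1 : ℝ) ≤ N := by exact_mod_cast NeZero.pos N
  refine graph_adj.2 ⟨hne, (U s(x, y)).2.2.trans (le_min ?_ le_rfl)⟩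
  rw [one_le_div (Real.rpow_pos_of_pos (by linarith) _)]
  refine le_trans (Real.rpow_le_rpow_of_exponent_le hN ?_) (hc _ (hdist_pos hne))
  rw [mul_comm]
  have : (hdist x y : ℝ) ≤ K := by exact_mod_cast h
  exact mul_le_mul_of_nonneg_left this (by linarith)

theorem cl_graph_eq_cell [NeZero N] (hδ : -1 < δ) {K : ℕ}
    (hc : ∀ j, 1 ≤ j → (N : ℝ) ^ ((1 + δ) * K) ≤ c j) (U : Sample N) {k : ℕ} (hk : k ≤ K)
    (x : HGroup N) : cl (graph N δ c U) k x = cell x k := by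
  refine Set.Subset.antisymm cl_subset_cell fun y hy => ?_
  by_cases e : x = y
  · exact e ▸ self_mem_cl
  · exact Conn.of_adj (mem_cell_self x k) hy
      (graph_adj_of_hdist_le hδ hc U e (le_trans hy hk))

/-- There are at least `N ^ (2 * l) / 4` pairs, each an edge with probability at least `N ^ (-(1 +
δ) k)`; `σ * k` is a lower bound for the remaining exponent. -/
theorem prob_not_joined_le_exp [NeZero N] (hδ : -1 < δ) (hc : ∀ j, 1 ≤ j → 1 ≤ c j) {k l : ℕ}
    (hlk : l ≤ k) {σ : ℝ} (hσ : σ * k ≤ 2 * l - (1 + δ) * k) {x r s : HGroup N}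
    (hr : r ∈ reps x k l) (hs : s ∈ reps x k l) (hrs : r ≠ s) :
    prob N δ c (fun G => ¬ Joined G l r s) ≤
      ENNReal.ofReal (Real.exp (-((N : ℝ) ^ (σ * k) / 4))) := by
  have hN : (1 : ℝ) ≤ N := by exact_mod_cast NeZero.pos N
  have hN0 : (0 : ℝ) < N := by linarith
  have hd := disjoint_cell_of_mem_reps hr hs hrs
  refine (prob_not_joined_le hd (p := (N : ℝ) ^ (-((1 + δ) * k))) (Real.rpow_nonneg hN0.le _)
    ?_).trans ?_
  · intro y hy z hz
    have hy' := cell_subset_of_mem hlk (mem_cell_of_mem_reps hlk hr) hy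
    have hz' := cell_subset_of_mem hlk (mem_cell_of_mem_reps hlk hs) hz
    exact le_connProb hδ hc (hdist_pos fun e => Set.disjoint_left.1 hd hy (e ▸ hz))
      (hdist_le_trans (mem_cell_comm.1 hy') hz')
  · refine ENNReal.ofReal_le_ofReal (Real.exp_le_exp.2 (neg_le_neg ?_))
    rw [← mul_div_assoc, ← Real.rpow_natCast, ← Real.rpow_add hN0]
    refine div_le_div_of_nonneg_right (Real.rpow_le_rpow_of_exponent_le hN ?_) (by norm_num)
    push_cast
    linarith

end

end HierPerc

/-! ### The recursion over scales for dense clusters. -/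

namespace HierPerc

open Filter in
theorem eventually_pow_le_exp {N : ℕ} (hN : 2 ≤ N) {σ : ℝ} (hσ : 0 < σ) :
    ∀ᶠ k : ℕ in atTop, 2 * (N : ℝ) ^ (4 * k) ≤ Real.exp ((N : ℝ) ^ (σ * k) / 4) := by
  have hN1 : (1 : ℝ) < N := by exact_mod_cast hN
  have hN0 : (0 : ℝ) < N := by linarith
  have h1 := (isLittleO_rpow_exp_pos_mul_atTop (4 / σ) (by norm_num : (0 : ℝ) < 1 / 4)).bound
    (by norm_num : (0 : ℝ) < 1 / 2)
  have h2 : Tendsto (fun k : ℕ => (N : ℝ) ^ (σ * k)) atTop atTop := by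
    refine (tendsto_rpow_atTop_of_base_gt_one _ hN1).comp ?_
    exact tendsto_natCast_atTop_atTop.const_mul_atTop hσ
  filter_upwards [h2.eventually h1] with k hk
  rw [Real.norm_of_nonneg (Real.rpow_nonneg (Real.rpow_nonneg hN0.le _) _),
    Real.norm_of_nonneg (Real.exp_pos _).le, ← Real.rpow_mul hN0.le] at hk
  have e : σ * k * (4 / σ) = ((4 * k : ℕ) : ℝ) := by
    push_cast
    field_simp
  rw [e, Real.rpow_natCast] at hk
  have e2 : 1 / 4 * (N : ℝ) ^ (σ * k) = (N : ℝ) ^ (σ * k) / 4 := by ring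
  rw [e2] at hk
  linarith

open Filter in
theorem eventually_sq_le_two_pow {A : ℕ} (hA : 0 < A) :
    ∀ᶠ k : ℕ in atTop, k ^ 2 ≤ 2 ^ (k / A) := by
  have h1 : Tendsto (fun n : ℕ => (n : ℝ) ^ 2 / 2 ^ n) atTop (nhds 0) :=
    tendsto_pow_const_div_const_pow_of_one_lt 2 (by norm_num)
  have hpos : (0 : ℝ) < 1 / (2 * (A : ℝ) ^ 2) := by positivity
  have h2 : Tendsto (fun k : ℕ => k / A + 1) atTop atTop :=
    (tendsto_add_atTop_nat 1).comp (Nat.tendsto_div_const_atTop hA.ne')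
  filter_upwards [h2.eventually (h1.eventually (gt_mem_nhds hpos))] with k hk
  have hlt : k < A * (k / A + 1) := by
    rw [mul_add, mul_one]
    exact Nat.lt_mul_div_succ k hA |>.trans_eq (by ring)
  rw [div_lt_div_iff₀ (by positivity) (by positivity), one_mul] at hk
  have h3 : (k / A + 1) ^ 2 * (2 * A ^ 2) < 2 ^ (k / A + 1) := by exact_mod_cast hk
  have h4 : k ^ 2 ≤ (A * (k / A + 1)) ^ 2 := Nat.pow_le_pow_left hlt.le 2
  rw [mul_pow] at h4
  rw [pow_succ 2 (k / A)] at h3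
  nlinarith

/-- The scale below which the random graph is complete is large enough for the renormalization. -/
structure IsBaseScale (N : ℕ) (δ : ℝ) (A K : ℕ) : Prop where
  four_le : 4 ≤ K
  four_le_step : 4 ≤ A
  step : 4 ≤ (A : ℝ) * (1 - δ)
  pow_le_exp : ∀ k : ℕ, K ≤ k →
    2 * (N : ℝ) ^ (4 * k) ≤ Real.exp ((N : ℝ) ^ ((1 - δ) / 2 * k) / 4)
  sq_le : ∀ k : ℕ, K ≤ k → k ^ 2 ≤ 2 ^ (k / A)
  base_le : 3 + δ ≤ K * (1 - δ)

theorem exists_isBaseScale {N : ℕ} (hN : 2 ≤ N) {δ : ℝ} (hδ : δ < 1) :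
    ∃ A K, IsBaseScale N δ A K := by
  have hpos : 0 < 1 - δ := by linarith
  obtain ⟨a, ha⟩ := exists_nat_ge (4 / (1 - δ))
  rw [div_le_iff₀ hpos] at ha
  obtain ⟨b, hb⟩ := exists_nat_ge ((3 + δ) / (1 - δ))
  rw [div_le_iff₀ hpos] at hb
  obtain ⟨K₁, h₁⟩ := Filter.eventually_atTop.1
    (eventually_pow_le_exp hN (σ := (1 - δ) / 2) (by linarith))
  obtain ⟨K₂, h₂⟩ := Filter.eventually_atTop.1 (eventually_sq_le_two_pow (A := max a 4) (by simp))
  refine ⟨max a 4, max (max 4 b) (max K₁ K₂), by simp, by simp, ha.trans ?_,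
    fun k hk => h₁ k (by omega), fun k hk => h₂ k (by omega), hb.trans ?_⟩
  · exact mul_le_mul_of_nonneg_right (by exact_mod_cast le_max_left a 4) hpos.le
  · refine mul_le_mul_of_nonneg_right ?_ hpos.le
    exact_mod_cast (le_max_right 4 b).trans (le_max_left _ _)

variable {N : ℕ} {δ : ℝ} {c : ℕ → ℝ} {A K : ℕ}

/-- Losing one of `M = N ^ (k / A)` sub-balls costs a fraction `1 / M` of the density. The slack `1
/ l - 1 / k` pays for this because `M ≥ k ^ 2`, so the density always stays above `3 / 4`. -/
theorem IsBaseScale.density_step (hN : 2 ≤ N) (h : IsBaseScale N δ A K) {k : ℕ} (hk : K < k) :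
    ((3 / 4 : ℝ) + 1 / k) * (N : ℝ) ^ k ≤ ((N : ℝ) ^ (k - (k - k / A)) - 1) *
      ((3 / 4 + 1 / ((k - k / A : ℕ) : ℝ)) * (N : ℝ) ^ (k - k / A)) := by
  have hN1 : (2 : ℝ) ≤ N := by exact_mod_cast hN
  have hk4 := h.four_le
  have hA4 := h.four_le_step
  have hg4 : k / A ≤ k / 4 := Nat.div_le_div_left hA4 (by norm_num)
  have hsq := h.sq_le k hk.le
  have hg1 : 1 ≤ k / A := by
    by_contra h0
    have h0 : k / A = 0 := Nat.lt_one_iff.1 (not_le.1 h0)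
    rw [h0, pow_zero] at hsq
    nlinarith
  set g := k / A with hg
  set l := k - g with hl
  have hlg : k - l = g := by omega
  have hk' : k = l + g := by omega
  rw [hlg, hk', pow_add]
  have hl4 : (4 : ℝ) ≤ l := by
    have : 4 ≤ l := by omega
    exact_mod_cast this
  have hgr : (1 : ℝ) ≤ g := by exact_mod_cast hg1
  have hM : ((l : ℝ) + g) ^ 2 ≤ (N : ℝ) ^ g := by
    have h1 : ((k : ℝ)) ^ 2 ≤ 2 ^ g := by exact_mod_cast hsq
    have h2 : (2 : ℝ) ^ g ≤ (N : ℝ) ^ g := by gcongr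
    rw [hk'] at h1
    push_cast at h1
    linarith
  set M : ℝ := (N : ℝ) ^ g with hMdef
  have hM0 : 0 < M := by positivity
  have key : ((3 / 4 : ℝ) + 1 / (l + g)) * M ≤ (M - 1) * (3 / 4 + 1 / l) := by
    have h1 : (1 : ℝ) / l - 1 / (l + g) = g / (l * (l + g)) := by
      field_simp
      ring
    -- The gain, `M` times the slack, is at least `1`; the cost `3 / 4 + 1 / l` of one sub-ball is
    -- at most `1` because `l ≥ 4`.
    have h2 : (1 : ℝ) ≤ M * (g / (l * (l + g))) := by
      rw [← mul_div_assoc, one_le_div (by positivity)]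
      nlinarith
    have h3 : (1 : ℝ) / l ≤ 1 / 4 := one_div_le_one_div_of_le (by norm_num) hl4
    rw [← h1] at h2
    nlinarith
  have hl0 : (0 : ℝ) ≤ (N : ℝ) ^ l := by positivity
  push_cast
  calc ((3 / 4 : ℝ) + 1 / (l + g)) * ((N : ℝ) ^ l * M)
      = (((3 / 4 : ℝ) + 1 / (l + g)) * M) * (N : ℝ) ^ l := by ring
    _ ≤ ((M - 1) * (3 / 4 + 1 / l)) * (N : ℝ) ^ l := mul_le_mul_of_nonneg_right key hl0
    _ = _ := by ring

/-- Every ball has a cluster of density more than `3 / 4` with high probability. -/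
theorem IsBaseScale.prob_not_hasCluster_le [NeZero N] (hN : 2 ≤ N) (hδ : -1 < δ)
    (h : IsBaseScale N δ A K) (hc : ∀ j, 1 ≤ j → (N : ℝ) ^ ((1 + δ) * K) ≤ c j) :
    ∀ k : ℕ, 4 ≤ k → ∀ x : HGroup N,
      prob N δ c (fun G => ¬ HasCluster x k ((3 / 4 + 1 / (k : ℝ)) * (N : ℝ) ^ k) G) ≤
        ENNReal.ofReal (((N : ℝ) ^ (2 * k))⁻¹) := by
  have hN1 : (2 : ℝ) ≤ N := by exact_mod_cast hN
  have hc1 : ∀ j, 1 ≤ j → 1 ≤ c j := fun j hj => by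
    refine le_trans (Real.one_le_rpow (by linarith) ?_) (hc j hj)
    have : 0 ≤ 1 + δ := by linarith
    positivity
  intro k
  induction k using Nat.strong_induction_on with
  | _ k ih =>
  intro hk4 x
  rcases le_or_gt k K with hkK | hkK
  -- The ball is complete here, and `k ≥ 4` makes the required density at most `1`.
  · have : prob N δ c (fun G => ¬ HasCluster x k ((3 / 4 + 1 / (k : ℝ)) * (N : ℝ) ^ k) G) = 0 := by
      rw [prob]
      convert measure_empty (μ := law N)
      ext U
      simp only [Set.mem_ofPred_eq, Set.mem_empty_iff_false, iff_false, not_not]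
      refine ⟨x, mem_cell_self x k, ?_⟩
      rw [cl_graph_eq_cell hδ hc U hkK x, cell_ncard]
      push_cast
      have h4 : (4 : ℝ) ≤ k := by exact_mod_cast hk4
      have h3 : (1 : ℝ) / k ≤ 1 / 4 := one_div_le_one_div_of_le (by norm_num) h4
      exact mul_le_of_le_one_left (by positivity) (by linarith)
    rw [this]
    exact zero_le
  · have hdens := h.density_step hN hkK
    have hK4 := h.four_le
    have hg4 : k / A ≤ k / 4 := Nat.div_le_div_left h.four_le_step (by norm_num)
    have hg1 : 1 ≤ k / A := by
      have hsq := h.sq_le k hkK.le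
      by_contra h0
      have h0 : k / A = 0 := Nat.lt_one_iff.1 (not_le.1 h0)
      rw [h0, pow_zero] at hsq
      -- A zero step `k / A` would force `k ^ 2 ≤ 1`.
      nlinarith
    have hgA : ((k / A : ℕ) : ℝ) * 4 ≤ k * (1 - δ) := by
      have h1 : ((k / A : ℕ) : ℝ) * A ≤ k := by exact_mod_cast Nat.div_mul_le_self k A
      have h2 := h.step
      have h3 : (0 : ℝ) ≤ ((k / A : ℕ) : ℝ) := by positivity
      have hpos : 0 ≤ 1 - δ := by
        by_contra hneg
        have : (A : ℝ) * (1 - δ) ≤ 0 :=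
          mul_nonpos_of_nonneg_of_nonpos (by positivity) (by linarith)
        linarith
      nlinarith
    set g := k / A with hg
    set l := k - g with hl
    have hlg : k - l = g := by omega
    have hlk : l ≤ k := by omega
    have hkl : (l : ℝ) = k - g := by rw [hl, Nat.cast_sub (by omega)]
    have hl4 : 4 ≤ l := by omega
    have step := HierPerc.prob_not_hasCluster_le (δ := δ) (c := c) hlk (x := x)
      (a := (3 / 4 + 1 / (l : ℝ)) * (N : ℝ) ^ l)
      (by rw [hlg]; exact (by omega : 2 ≤ N).trans (Nat.le_self_pow (by omega) N))
      (by
        have h1 : (0 : ℝ) < (N : ℝ) ^ l := by positivity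
        have h2 : (0 : ℝ) ≤ 1 / l := by positivity
        nlinarith)
      (fun r _ => ih l (by omega) hl4 r)
      -- The available exponent is `2 l - (1 + δ) k = (1 - δ) k - 2 g`, and `4 g ≤ (1 - δ) k` leaves
      -- half of `(1 - δ) k`.
      (fun r hr s hs hrs => prob_not_joined_le_exp hδ hc1 hlk (σ := (1 - δ) / 2)
        (by rw [hkl]; linarith) hr hs hrs)
    refine (prob_mono fun G hG hG' => ?_).trans (step.trans ?_)
    · obtain ⟨z, hz, hza⟩ := hG'
      exact hG ⟨z, hz, hdens.trans hza⟩
    · rw [hlg, ← ENNReal.ofReal_pow (by positivity), ← ENNReal.ofReal_add (by positivity)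
        (Real.exp_pos _).le, ← ENNReal.ofReal_natCast, ← ENNReal.ofReal_mul (by positivity)]
      refine ENNReal.ofReal_le_ofReal ?_
      have hexp : Real.exp (-((N : ℝ) ^ ((1 - δ) / 2 * k) / 4)) ≤ (2 * (N : ℝ) ^ (4 * k))⁻¹ := by
        rw [Real.exp_neg]
        exact inv_anti₀ (by positivity) (h.pow_le_exp k hkK.le)
      have e1 : (N : ℝ) ^ g * (N : ℝ) ^ g * (2 * (N : ℝ) ^ (4 * k))⁻¹ ≤
          ((N : ℝ) ^ (2 * k))⁻¹ / 2 := by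
        rw [← pow_add, mul_inv, div_eq_mul_inv, mul_comm _ (2⁻¹ : ℝ), mul_left_comm]
        refine mul_le_mul_of_nonneg_left ?_ (by norm_num)
        rw [← div_eq_mul_inv, div_le_iff₀ (by positivity), ← div_eq_inv_mul,
          le_div_iff₀ (by positivity), ← pow_add]
        exact pow_le_pow_right₀ (by linarith) (by omega)
      -- Squaring gives `N ^ (-4 l)`; since `g ≤ k / 4`, this beats the number of pairs `N ^ (2 g)`
      -- and leaves `N ^ (-2 k)`.
      have e2 : (N : ℝ) ^ g * (N : ℝ) ^ g * (((N : ℝ) ^ (2 * l))⁻¹) ^ 2 ≤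
          ((N : ℝ) ^ (2 * k))⁻¹ / 2 := by
        rw [inv_pow, ← pow_mul, ← pow_add, ← div_eq_mul_inv, div_le_iff₀ (by positivity),
          div_mul_eq_mul_div, ← div_eq_inv_mul, le_div_iff₀ (by norm_num),
          le_div_iff₀ (by positivity)]
        calc (N : ℝ) ^ (g + g) * 2 * (N : ℝ) ^ (2 * k)
            ≤ (N : ℝ) ^ (g + g) * N * (N : ℝ) ^ (2 * k) := by gcongr
          _ = (N : ℝ) ^ (g + g + 1 + 2 * k) := by ring
          _ ≤ (N : ℝ) ^ (2 * l * 2) := pow_le_pow_right₀ (by linarith) (by omega)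
      push_cast
      have := mul_le_mul_of_nonneg_left hexp (a := (N : ℝ) ^ g * (N : ℝ) ^ g) (by positivity)
      rw [mul_add]
      linarith

/-- A union bound over the `N` sub-balls and their pairs. Here the scale grows only by one, so the
joining exponent is `2 k - (1 + δ) (k + 1)`; `base_le` keeps it at least `(1 - δ) / 2 * (k + 1)`. -/
theorem IsBaseScale.prob_not_linked_le [NeZero N] (hN : 2 ≤ N) (hδ : -1 < δ)
    (h : IsBaseScale N δ A K) (hc : ∀ j, 1 ≤ j → (N : ℝ) ^ ((1 + δ) * K) ≤ c j) {k : ℕ}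
    (hk : K ≤ k) :
    prob N δ c (fun G => ¬ Linked G k) ≤ ENNReal.ofReal ((1 / 2) ^ k) := by
  classical
  have hN1 : (2 : ℝ) ≤ N := by exact_mod_cast hN
  have hc1 : ∀ j, 1 ≤ j → 1 ≤ c j := fun j hj => by
    refine le_trans (Real.one_le_rpow (by linarith) ?_) (hc j hj)
    have : 0 ≤ 1 + δ := by linarith
    positivity
  have hK4 := h.four_le
  set R := reps (0 : HGroup N) (k + 1) k with hR
  have hcard : R.card = N := by
    rw [hR, card_reps _ (Nat.le_succ k)]
    simp
  have hsub : prob N δ c (fun G => ¬ Linked G k) ≤ prob N δ c (fun G =>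
      (∃ r ∈ R, ¬ HasCluster r k ((3 / 4 + 1 / (k : ℝ)) * (N : ℝ) ^ k) G) ∨
        ∃ p ∈ R.offDiag, ¬ Joined G k p.1 p.2) := by
    refine prob_mono fun G hG => ?_
    by_contra hno
    push Not at hno
    refine hG ⟨fun r hr => ?_, fun r hr s hs hrs =>
      hno.2 (r, s) (Finset.mem_offDiag.2 ⟨hr, hs, hrs⟩)⟩
    obtain ⟨z, hz, hza⟩ := hno.1 r hr
    refine ⟨z, hz, ?_⟩
    have h1 : (0 : ℝ) < (N : ℝ) ^ k := by positivity
    have h2 : (0 : ℝ) ≤ 1 / k := by positivity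
    have h3 : (N : ℝ) ^ k < 2 * (cl G k z).ncard := by nlinarith
    unfold InMajority
    exact_mod_cast h3
  have b1 := prob_exists_mem_le_mul (N := N) (δ := δ) (c := c) R
    (fun r G => ¬ HasCluster r k ((3 / 4 + 1 / (k : ℝ)) * (N : ℝ) ^ k) G)
    (fun r _ => h.prob_not_hasCluster_le hN hδ hc k (by omega) r)
  have b2 := prob_exists_mem_le_mul (N := N) (δ := δ) (c := c) R.offDiag
    (fun p G => ¬ Joined G k p.1 p.2)
    (q := ENNReal.ofReal (Real.exp (-((N : ℝ) ^ ((1 - δ) / 2 * ((k + 1 : ℕ) : ℝ)) / 4))))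
    (fun p hp => by
      rw [Finset.mem_offDiag] at hp
      refine prob_not_joined_le_exp hδ hc1 (Nat.le_succ k) ?_ hp.1 hp.2.1 hp.2.2
      have h1 := h.base_le
      have h2 : (K : ℝ) ≤ k := by exact_mod_cast hk
      have hpos : 0 ≤ 1 - δ := by
        by_contra hneg
        have : (K : ℝ) * (1 - δ) ≤ 0 :=
          mul_nonpos_of_nonneg_of_nonpos (by positivity) (by linarith)
        linarith
      push_cast
      nlinarith [mul_le_mul_of_nonneg_right h2 hpos])
  refine hsub.trans ((prob_or_le _ _).trans ((add_le_add b1 b2).trans ?_))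
  have hoff : (R.offDiag.card : ENNReal) ≤ ((N * N : ℕ) : ENNReal) := by
    rw [Nat.cast_le, Finset.offDiag_card, hcard]
    exact Nat.sub_le _ _
  refine (add_le_add_right (mul_le_mul_left hoff _) _).trans ?_
  rw [hcard, ← ENNReal.ofReal_natCast, ← ENNReal.ofReal_natCast,
    ← ENNReal.ofReal_mul (by positivity), ← ENNReal.ofReal_mul (by positivity),
    ← ENNReal.ofReal_add (by positivity) (by positivity)]
  refine ENNReal.ofReal_le_ofReal ?_
  have hexp : Real.exp (-((N : ℝ) ^ ((1 - δ) / 2 * ((k + 1 : ℕ) : ℝ)) / 4)) ≤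
      (2 * (N : ℝ) ^ (4 * (k + 1)))⁻¹ := by
    rw [Real.exp_neg]
    exact inv_anti₀ (by positivity) (h.pow_le_exp (k + 1) (by omega))
  have e1 : (N : ℝ) * ((N : ℝ) ^ (2 * k))⁻¹ ≤ (1 / 2) ^ k / 2 := by
    rw [← div_eq_mul_inv, div_le_iff₀ (by positivity), one_div, inv_pow, inv_eq_one_div,
      div_div, div_mul_eq_mul_div, one_mul, le_div_iff₀ (by positivity), ← pow_succ]
    calc (N : ℝ) * 2 ^ (k + 1) ≤ (N : ℝ) * (N : ℝ) ^ (k + 1) := by gcongr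
      _ = (N : ℝ) ^ (k + 2) := by ring
      _ ≤ (N : ℝ) ^ (2 * k) := pow_le_pow_right₀ (by linarith) (by omega)
  have e2 : (N : ℝ) * N * (2 * (N : ℝ) ^ (4 * (k + 1)))⁻¹ ≤ (1 / 2) ^ k / 2 := by
    rw [← div_eq_mul_inv, div_le_iff₀ (by positivity), one_div, inv_pow, inv_eq_one_div,
      div_div, div_mul_eq_mul_div, one_mul, le_div_iff₀ (by positivity), ← pow_succ]
    calc (N : ℝ) * N * 2 ^ (k + 1) ≤ (N : ℝ) * N * (N : ℝ) ^ (k + 1) := by gcongr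
      _ = (N : ℝ) ^ (k + 3) := by ring
      _ ≤ (N : ℝ) ^ (4 * (k + 1)) := pow_le_pow_right₀ (by linarith) (by omega)
      _ ≤ 2 * (N : ℝ) ^ (4 * (k + 1)) := by
        have : (0 : ℝ) ≤ (N : ℝ) ^ (4 * (k + 1)) := by positivity
        linarith
  have := mul_le_mul_of_nonneg_left hexp (a := (N : ℝ) * N) (by positivity)
  push_cast at this ⊢
  linarith

end HierPerc

/-! ### Deterministic consequences of linked scales: chains, infinite clusters, hits. -/

namespace HierPerc

section

variable {N : ℕ} {G : SimpleGraph (HGroup N)} {k m : ℕ} {x y : HGroup N}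

theorem mem_of_reachable {S : Set (HGroup N)} (hS : ∀ a ∈ S, ∀ b, G.Adj a b → b ∈ S)
    (hx : x ∈ S) (h : G.Reachable x y) : y ∈ S := by
  obtain ⟨p⟩ := h
  induction p with
  | nil => exact hx
  | cons hadj _ ih => exact ih (hS _ hx _ hadj)

theorem exists_adj_of_infinite [NeZero N] {S : Set (HGroup N)} (hS : S.Finite) (hx : x ∈ S)
    (h : (G.connectedComponentMk x).supp.Infinite) : ∃ a ∈ S, ∃ b, b ∉ S ∧ G.Adj a b := by
  by_contra hno
  push Not at hno
  refine h (hS.subset fun y hy => ?_)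
  rw [SimpleGraph.ConnectedComponent.mem_supp_iff, SimpleGraph.ConnectedComponent.eq] at hy
  refine mem_of_reachable (fun a ha b hab => ?_) hx hy.symm
  by_contra hb
  exact hno a ha b hb hab

theorem mem_ballClusters {C : Set (HGroup N)} :
    C ∈ ballClusters G k ↔ ∃ z ∈ cell 0 k, C = cl G k z := by
  have key : ∀ z : ball N k, Subtype.val '' ((G.induce (ball N k)).connectedComponentMk z).supp =
      cl G k z := by
    intro z
    ext w
    rw [cl, cell_eq_of_mem z.2]
    constructor
    · rintro ⟨v, hv, rfl⟩
      rw [SimpleGraph.ConnectedComponent.mem_supp_iff, SimpleGraph.ConnectedComponent.eq] at hv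
      exact ⟨z.2, v.2, hv.symm⟩
    · rintro ⟨_, hw, h⟩
      refine ⟨⟨w, hw⟩, ?_, rfl⟩
      rw [SimpleGraph.ConnectedComponent.mem_supp_iff, SimpleGraph.ConnectedComponent.eq]
      exact h.symm
  constructor
  · rintro ⟨K, rfl⟩
    induction K using SimpleGraph.ConnectedComponent.ind with
    | _ v => exact ⟨v, v.2, key v⟩
  · rintro ⟨z, hz, rfl⟩
    exact ⟨_, (key ⟨z, hz⟩).symm⟩

/-- A cluster at least as large as a majority cluster is itself a majority cluster, hence the same
one. This disposes of ties between largest clusters. -/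
theorem InMajority.isLargestCluster_iff [NeZero N] (hy : y ∈ cell 0 k) (my : InMajority G k y)
    {C : Set (HGroup N)} : IsLargestCluster G k C ↔ C = cl G k y := by
  have huniq : ∀ z ∈ cell (0 : HGroup N) k, InMajority G k z → cl G k z = cl G k y :=
    fun z hz mz => cl_eq_of_mem (my.mem_cl mz (by rw [cell_eq_of_mem hy]; exact hz))
  constructor
  · rintro ⟨hC, hmax⟩
    obtain ⟨z, hz, rfl⟩ := mem_ballClusters.1 hC
    refine huniq z hz ?_
    have := hmax _ (mem_ballClusters.2 ⟨y, hy, rfl⟩)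
    unfold InMajority at my ⊢
    omega
  · rintro rfl
    refine ⟨mem_ballClusters.2 ⟨y, hy, rfl⟩, fun D hD => ?_⟩
    obtain ⟨z, hz, rfl⟩ := mem_ballClusters.1 hD
    by_contra hlt
    rw [huniq z hz (by unfold InMajority at my ⊢; omega)] at hlt
    exact hlt le_rfl

theorem infinite_of_linked [NeZero N] (hN : 2 ≤ N) (h : ∀ k, m ≤ k → Linked G k)
    (hy : y ∈ cell 0 m) (my : InMajority G m y) :
    (G.connectedComponentMk y).supp.Infinite := by
  intro hfin
  have hle : ∀ k, m ≤ k → N ^ k < 2 * (G.connectedComponentMk y).supp.ncard := by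
    intro k hk
    refine lt_of_lt_of_le (Linked.inMajority_of_le h hy my hk)
      (Nat.mul_le_mul_left 2 (Set.ncard_le_ncard (fun w hw => ?_) hfin))
    rw [SimpleGraph.ConnectedComponent.mem_supp_iff, SimpleGraph.ConnectedComponent.eq]
    exact (Conn.reachable hw).symm
  set n := (G.connectedComponentMk y).supp.ncard
  have h1 := hle (m + 2 * n) (by omega)
  have h2 : m + 2 * n < N ^ (m + 2 * n) := Nat.lt_pow_self hN
  omega

theorem tendsto_kseq : Filter.Tendsto kseq Filter.atTop Filter.atTop := by
  refine tendsto_nat_floor_atTop.comp ?_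
  exact tendsto_natCast_atTop_atTop.atTop_mul_atTop₀
    (Real.tendsto_log_atTop.comp tendsto_natCast_atTop_atTop)

theorem kseq_le_succ (n : ℕ) : kseq n ≤ kseq (n + 1) := by
  refine Nat.floor_le_floor ?_
  rcases Nat.eq_zero_or_pos n with rfl | hn
  · simp
  · have hn' : (1 : ℝ) ≤ n := by exact_mod_cast hn
    have h1 : Real.log n ≤ Real.log ((n + 1 : ℕ) : ℝ) :=
      Real.log_le_log (by linarith) (by push_cast; linarith)
    exact mul_le_mul (by push_cast; linarith) h1 (Real.log_nonneg hn') (by positivity)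

/-- From scale `m` on, the largest cluster is the cluster of the fixed point `y`, which grows with
the ball. Its density above `1 / 2` exceeds `N ^ (γ k)` once `(1 - γ) k ≥ 1`. Of `kseq` only
monotonicity and divergence matter. -/
theorem exists_chainFrom [NeZero N] (hN : 2 ≤ N) (h : ∀ k, m ≤ k → Linked G k)
    (hy : y ∈ cell 0 m) (my : InMajority G m y) {γ : ℝ} (hγ : γ < 1) :
    ∃ n, m ≤ kseq n ∧ ChainFrom G γ n := by
  have hpos : 0 < 1 - γ := by linarith
  obtain ⟨a, ha⟩ := exists_nat_ge (1 / (1 - γ))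
  rw [div_le_iff₀ hpos] at ha
  obtain ⟨n₀, hn₀⟩ := Filter.eventually_atTop.1
    (tendsto_kseq.eventually (Filter.eventually_ge_atTop (max m a)))
  have hmaj : ∀ k, m ≤ k → y ∈ cell 0 k ∧ InMajority G k y := fun k hk =>
    ⟨cell_mono 0 hk hy, Linked.inMajority_of_le h hy my hk⟩
  refine ⟨n₀, (le_max_left _ _).trans (hn₀ n₀ le_rfl), fun n hn => ?_⟩
  have hk := hn₀ n hn
  have hmk : m ≤ kseq n := (le_max_left _ _).trans hk
  obtain ⟨hyk, myk⟩ := hmaj _ hmk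
  obtain ⟨hyk', myk'⟩ := hmaj (kseq (n + 1)) (hmk.trans (kseq_le_succ n))
  refine ⟨⟨cl G (kseq n) y, (myk.isLargestCluster_iff hyk).2 rfl, ?_⟩, fun C C' hC hC' => ?_⟩
  · have hak : (a : ℝ) ≤ kseq n := by exact_mod_cast (le_max_right _ _).trans hk
    have hN2 : (2 : ℝ) ≤ N := by exact_mod_cast hN
    have hN0 : (0 : ℝ) < N := by linarith
    have h1 : (2 : ℝ) ≤ (N : ℝ) ^ ((1 - γ) * kseq n) := by
      refine hN2.trans ?_
      conv_lhs => rw [← Real.rpow_one (N : ℝ)]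
      exact Real.rpow_le_rpow_of_exponent_le (by linarith) (by nlinarith)
    have h2 : (N : ℝ) ^ (γ * kseq n) * (N : ℝ) ^ ((1 - γ) * kseq n) = (N : ℝ) ^ kseq n := by
      rw [← Real.rpow_add hN0, ← Real.rpow_natCast]
      congr 1
      ring
    have h3 : (N : ℝ) ^ kseq n ≤ 2 * (cl G (kseq n) y).ncard := by exact_mod_cast myk.le
    have h4 : 0 ≤ (N : ℝ) ^ (γ * kseq n) := Real.rpow_nonneg hN0.le _
    nlinarith
  · rw [(myk.isLargestCluster_iff hyk).1 hC, (myk'.isLargestCluster_iff hyk').1 hC']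
    exact cl_mono (kseq_le_succ n)

/-- The points at distance exactly `k + 1` from the origin. -/
def shell (N k : ℕ) : Set (HGroup N) := cell 0 (k + 1) \ cell 0 k

/-- The points at distance `k + 1` from the origin that belong to the majority clusters of their
`k`-balls. -/
def majShell (G : SimpleGraph (HGroup N)) (k : ℕ) : Set (HGroup N) :=
  {z | z ∈ shell N k ∧ InMajority G k z}

/-- The cluster of `x` in the `k`-ball has an edge into the next shell. -/
def Exits (x : HGroup N) (k : ℕ) (G : SimpleGraph (HGroup N)) : Prop :=
  ¬ NoEdge (cl G k x) (shell N k) G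

/-- The next shell is mostly outside majority clusters, or the cluster of `x` in the `k`-ball has
an edge to a majority cluster of this shell. -/
def Hits (x : HGroup N) (k : ℕ) (G : SimpleGraph (HGroup N)) : Prop :=
  2 * (majShell G k).ncard < (shell N k).ncard ∨ ¬ NoEdge (cl G k x) (majShell G k) G

/-- There is no hit from scale `m` up to scale `k`. -/
def NoHit (x : HGroup N) (m k : ℕ) (G : SimpleGraph (HGroup N)) : Prop :=
  ∀ j, m ≤ j → j < k → ¬ Hits x j G

theorem shell_finite [NeZero N] : (shell N k).Finite := (cell_finite 0 (k + 1)).sdiff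

theorem majShell_subset : majShell G k ⊆ shell N k := fun _ h => h.1

theorem hdist_of_mem_shell {z : HGroup N} {j : ℕ} (hy : y ∈ cell 0 k) (hkj : k ≤ j)
    (hz : z ∈ shell N j) : hdist y z = j + 1 := by
  have hy' := cell_mono 0 hkj hy
  refine le_antisymm (hdist_le_trans (mem_cell_comm.1 (cell_mono 0 (Nat.le_succ j) hy')) hz.1) ?_
  by_contra hlt
  exact hz.2 (hdist_le_trans hy' (by omega : hdist y z ≤ j))

/-- The shell is a union of `k`-balls, and each of them has a majority cluster; compare both sides
ball by ball. -/
theorem Linked.ncard_shell_le [NeZero N] (h : Linked G k) :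
    (shell N k).ncard ≤ 2 * (majShell G k).ncard := by
  classical
  have hmf : (majShell G k).Finite := shell_finite.subset majShell_subset
  rw [Set.ncard_eq_toFinset_card _ shell_finite, Set.ncard_eq_toFinset_card _ hmf]
  set R := (shell_finite (N := N) (k := k)).toFinset.image (trunc k) with hR
  rw [Finset.card_eq_sum_card_fiberwise (f := trunc k) (t := R)
      (fun z hz => Finset.mem_image_of_mem _ hz),
    Finset.card_eq_sum_card_fiberwise (f := trunc k) (s := hmf.toFinset) (t := R)
      (fun z hz => Finset.mem_image_of_mem _ (by
        rw [Set.Finite.mem_toFinset]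
        exact majShell_subset (by simpa using hz))), Finset.mul_sum]
  refine Finset.sum_le_sum fun r hr => ?_
  obtain ⟨w, hw, rfl⟩ := Finset.mem_image.1 hr
  rw [Set.Finite.mem_toFinset] at hw
  obtain ⟨z, hz, mz⟩ := h.exists_inMajority hw.1
  have hcell : cell w k ⊆ shell N k := by
    intro v hv
    refine ⟨cell_subset_of_mem (Nat.le_succ k) hw.1 hv, fun hv0 => hw.2 ?_⟩
    exact hdist_le_trans hv0 (mem_cell_comm.1 hv)
  have h1 : ((shell_finite (N := N) (k := k)).toFinset.filter fun v => trunc k v = trunc k w).card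
      ≤ N ^ k := by
    rw [← cell_ncard w k, Set.ncard_eq_toFinset_card _ (cell_finite w k)]
    refine Finset.card_le_card fun v hv => ?_
    rw [Finset.mem_filter] at hv
    rw [Set.Finite.mem_toFinset]
    exact trunc_eq_iff.1 hv.2.symm
  have h2 : (cl G k z).ncard ≤ (hmf.toFinset.filter fun v => trunc k v = trunc k w).card := by
    rw [Set.ncard_eq_toFinset_card _ cl_finite]
    refine Finset.card_le_card fun v hv => ?_
    rw [Set.Finite.mem_toFinset] at hv
    have hvw : v ∈ cell w k := by
      rw [← cell_eq_of_mem hz]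
      exact cl_subset_cell hv
    rw [Finset.mem_filter, Set.Finite.mem_toFinset]
    exact ⟨⟨hcell hvw, mz.of_mem_cl hv⟩, (trunc_eq_iff.2 hvw).symm⟩
  unfold InMajority at mz
  omega

/-- If all but finitely many exits are hits, then an infinite cluster meets the majority
clusters. -/
theorem reachable_of_linked [NeZero N] (h : ∀ k, m ≤ k → Linked G k) (hy : y ∈ cell 0 m)
    (my : InMajority G m y) (hx : x ∈ cell 0 m)
    (hinf : (G.connectedComponentMk x).supp.Infinite)
    (hexit : ∃ k₀, ∀ k, k₀ ≤ k → m ≤ k → NoHit x m k G → Exits x k G → Hits x k G) :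
    G.Reachable x y := by
  by_cases hhit : ∃ j, m ≤ j ∧ Hits x j G
  · obtain ⟨j, hj, hh⟩ := hhit
    rcases hh with hh | hh
    · exact absurd (h j hj).ncard_shell_le (not_le.2 hh)
    · unfold NoEdge at hh
      push Not at hh
      obtain ⟨v, hv, w, hw, hadj⟩ := hh
      have hyj := cell_mono 0 (hj.trans (Nat.le_succ j)) hy
      exact ((Conn.reachable hv).trans hadj.reachable).trans
        ((h j hj).conn hw.1.1 hyj hw.2 (Linked.inMajority_of_le h hy my hj)).reachable
  · exfalso
    push Not at hhit
    obtain ⟨k₀, hk₀⟩ := hexit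
    have hno : ∀ k, k₀ ≤ k → m ≤ k → NoEdge (cl G k x) (shell N k) G := by
      intro k h1 h2
      by_contra hne
      exact hhit k h2 (hk₀ k h1 h2 (fun j hj _ => hhit j hj) hne)
    set k := max k₀ m
    obtain ⟨a, ha, b, hb, hab⟩ := exists_adj_of_infinite (cl_finite (G := G) (k := k) (z := x))
      self_mem_cl hinf
    have hxk : x ∈ cell 0 k := cell_mono 0 (le_max_right _ _) hx
    by_cases hbk : b ∈ cell 0 k
    · have hc := conn_of_mem_cl hxk ha
      exact hb (mem_cl_of_cell hxk (hc.trans (Conn.of_adj hc.right_mem hbk hab)))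
    · have hlt : k < hdist 0 b := not_le.1 hbk
      -- The edge may jump over several shells. It is then an exit at the scale just below the
      -- distance of `b`, where the cluster of `x` still contains `a`.
      have hbs : b ∈ shell N (hdist 0 b - 1) := by
        constructor
        · rw [mem_cell]; omega
        · rw [mem_cell]; omega
      exact hno (hdist 0 b - 1) (by omega) (by omega) a (cl_mono (by omega) ha) b hbs hab

end

end HierPerc

/-! ### Exits and hits: the probabilistic part of uniqueness. -/

namespace HierPerc

section

variable {N : ℕ} {δ : ℝ} {c : ℕ → ℝ} {k m : ℕ} {x y : HGroup N}

/-- The pairs in the `(k + 1)`-ball around the origin at distance at most `k`. -/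
def innerPairs (N k : ℕ) : Set (HGroup N × HGroup N) :=
  {p | p ∈ cell (0 : HGroup N) (k + 1) ×ˢ cell (0 : HGroup N) (k + 1) ∧ hdist p.1 p.2 ≤ k}

theorem innerPairs_finite [NeZero N] : (innerPairs N k).Finite :=
  ((cell_finite 0 (k + 1)).prod (cell_finite 0 (k + 1))).subset fun _ h => h.1

theorem cell_prod_subset_innerPairs (hy : y ∈ cell 0 (k + 1)) :
    cell y k ×ˢ cell y k ⊆ innerPairs N k := by
  intro p hp
  have h := cell_subset_of_mem (Nat.le_succ k) hy
  exact ⟨⟨h hp.1, h hp.2⟩, hdist_le_trans (mem_cell_comm.1 hp.1) hp.2⟩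

theorem cl_congr_innerPairs (hy : y ∈ cell 0 (k + 1)) {G G' : SimpleGraph (HGroup N)}
    (h : ∀ p ∈ innerPairs N k, (G.Adj p.1 p.2 ↔ G'.Adj p.1 p.2)) : cl G k y = cl G' k y :=
  cl_congr (mem_cell_self y k) fun p hp => h p (cell_prod_subset_innerPairs hy hp)

theorem majShell_congr {G G' : SimpleGraph (HGroup N)}
    (h : ∀ p ∈ innerPairs N k, (G.Adj p.1 p.2 ↔ G'.Adj p.1 p.2)) :
    majShell G k = majShell G' k := by
  ext z
  refine and_congr_right fun hz => ?_
  rw [InMajority, InMajority, cl_congr_innerPairs hz.1 h]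

theorem Hits.localOn (hx : x ∈ cell 0 k) :
    LocalOn (cell (0 : HGroup N) (k + 1) ×ˢ cell (0 : HGroup N) (k + 1)) (Hits x k) := by
  intro G G' hG
  have hxk := cell_mono 0 (Nat.le_succ k) hx
  have hin : ∀ p ∈ innerPairs N k, (G.Adj p.1 p.2 ↔ G'.Adj p.1 p.2) := fun p hp => hG p hp.1
  unfold Hits
  rw [cl_congr_innerPairs hxk hin, majShell_congr hin]
  refine Or.imp id fun hno hno' => hno ?_
  refine NoEdge.localOn _ _ G' G (fun p hp => (hG p ⟨?_, hp.2.1.1⟩).symm) hno'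
  exact cell_subset_of_mem (Nat.le_succ k) hxk (cl_subset_cell hp.1)

theorem NoHit.localOn (hx : x ∈ cell 0 m) :
    LocalOn (cell (0 : HGroup N) k ×ˢ cell (0 : HGroup N) k) (NoHit x m k) :=
  LocalOn.all fun j => by
    by_cases hj : m ≤ j ∧ j < k
    · have h := (Hits.localOn (cell_mono 0 hj.1 hx)).not.mono
        (Set.prod_mono (cell_mono (0 : HGroup N) (show j + 1 ≤ k by omega))
          (cell_mono (0 : HGroup N) (show j + 1 ≤ k by omega)))
      exact fun G G' hG hP h1 h2 => h G G' hG (hP h1 h2)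
    · exact fun G G' _ _ h1 h2 => absurd ⟨h1, h2⟩ hj

theorem prob_not [NeZero N] {T : Set (HGroup N × HGroup N)} {P : SimpleGraph (HGroup N) → Prop}
    (h : LocalOn T P) (hT : T.Finite) :
    prob N δ c (fun G => ¬ P G) = 1 - prob N δ c P :=
  prob_compl_eq_one_sub (h.measurableSet hT δ c)

/-- By ultrametricity all pairs involved have distance exactly `k + 1`, so the probability depends
only on the number of pairs. -/
theorem prob_edge_mono [NeZero N] {S T T' : Finset (HGroup N)} (hS : ∀ y ∈ S, y ∈ cell 0 k)
    (hT : ∀ z ∈ T, z ∈ shell N k) (hT' : ∀ z ∈ T', z ∈ shell N k) (hle : T.card ≤ T'.card) :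
    prob N δ c (fun G => ¬ NoEdge (S : Set (HGroup N)) T G) ≤
      prob N δ c (fun G => ¬ NoEdge (S : Set (HGroup N)) T' G) := by
  have key : ∀ T : Finset (HGroup N), (∀ z ∈ T, z ∈ shell N k) →
      prob N δ c (fun G => ¬ NoEdge (S : Set (HGroup N)) T G) =
        1 - (1 - ENNReal.ofReal (connProb N δ c (k + 1))) ^ (S.card * T.card) := by
    intro T hT
    rw [prob_not (NoEdge.localOn _ _) (S.finite_toSet.prod T.finite_toSet), prob_noEdge S T
      (Finset.disjoint_left.2 fun y hy hy' => (hT y hy').2 (hS y hy)), ← Finset.card_product]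
    congr 1
    refine Finset.prod_eq_pow_card fun p hp => ?_
    rw [Finset.mem_product] at hp
    rw [hdist_of_mem_shell (hS _ hp.1) le_rfl (hT _ hp.2)]
  rw [key T hT, key T' hT']
  exact tsub_le_tsub_left (pow_le_pow_right_of_le_one' tsub_le_self (Nat.mul_le_mul_left _ hle)) _

/-- An exit is at least as likely to be a hit as not. -/
theorem prob_exit_le_prob_hit [NeZero N] (hx : x ∈ cell 0 m) (hmk : m ≤ k) :
    prob N δ c (fun G => NoHit x m k G ∧ Exits x k G ∧ ¬ Hits x k G) ≤
      prob N δ c (fun G => NoHit x m k G ∧ Hits x k G) := by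
  classical
  have hxk : x ∈ cell 0 k := cell_mono 0 hmk hx
  have hxk' : x ∈ cell 0 (k + 1) := cell_mono 0 (Nat.le_succ k) hxk
  let W : Finset (HGroup N) := (shell_finite (N := N) (k := k)).toFinset
  let I : Finset (Finset (HGroup N) × Finset (HGroup N)) :=
    ((cell_finite (0 : HGroup N) k).toFinset.powerset ×ˢ W.powerset).filter
      fun q => W.card ≤ 2 * q.2.card
  have hI : ∀ q ∈ I, (∀ y ∈ q.1, y ∈ cell 0 k) ∧ q.2 ⊆ W ∧ W.card ≤ 2 * q.2.card := by
    intro q hq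
    rw [Finset.mem_filter, Finset.mem_product, Finset.mem_powerset, Finset.mem_powerset] at hq
    exact ⟨fun y hy => by simpa using hq.1.1 hy, hq.1.2, hq.2⟩
  have hW : ∀ z ∈ W, z ∈ shell N k := fun z hz => by simpa [W] using hz
  -- Condition on the cluster of `x` and on the majority part of the shell. These and the history
  -- are determined by pairs at distance at most `k`, while exits use pairs at distance `k + 1`.
  let A : Finset (HGroup N) × Finset (HGroup N) → SimpleGraph (HGroup N) → Prop := fun q G =>
    NoHit x m k G ∧ cl G k x = q.1 ∧ majShell G k = q.2
  have hA : ∀ q, LocalOn (innerPairs N k) (A q) := by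
    intro q
    refine LocalOn.and ?_ (LocalOn.and ?_ ?_)
    · exact (NoHit.localOn hx).mono
        (cell_prod_subset_innerPairs (mem_cell_self (0 : HGroup N) (k + 1)))
    · exact LocalOn.of_eq (fun G => cl G k x) (fun _ _ h => cl_congr_innerPairs hxk' h)
        (· = (q.1 : Set (HGroup N)))
    · exact LocalOn.of_eq (fun G => majShell G k) (fun _ _ h => majShell_congr h)
        (· = (q.2 : Set (HGroup N)))
  have hB : ∀ S T : Finset (HGroup N), (∀ y ∈ S, y ∈ cell 0 k) → (∀ z ∈ T, z ∈ shell N k) →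
      LocalOn (cell (0 : HGroup N) k ×ˢ shell N k) fun G => ¬ NoEdge (S : Set (HGroup N)) T G :=
    fun S T hS hT => ((NoEdge.localOn _ _).mono (Set.prod_mono hS hT)).not
  have hmain := prob_exists_and_le_prob (N := N) (δ := δ) (c := c) I (T := innerPairs N k)
    (T' := cell (0 : HGroup N) k ×ˢ shell N k) (A := A)
    (B := fun q G => ¬ NoEdge (q.1 : Set (HGroup N)) ((W \ q.2 : Finset _) : Set (HGroup N)) G)
    (B' := fun q G => ¬ NoEdge (q.1 : Set (HGroup N)) q.2 G) (fun q _ => hA q) innerPairs_finite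
    (fun q hq => hB _ _ (hI q hq).1 fun z hz => hW z (Finset.mem_sdiff.1 hz).1)
    (fun q hq => hB _ _ (hI q hq).1 fun z hz => hW z ((hI q hq).2.1 hz))
    ((cell_finite 0 k).prod shell_finite)
    (disjoint_edgeSet_of_hdist (l := k) (fun p hp => hp.2)
      fun p hp => by rw [hdist_of_mem_shell hp.1 le_rfl hp.2]; exact Nat.lt_succ_self k)
    (fun G q _ q' _ h h' => Prod.ext (Finset.coe_injective (h.2.1.symm.trans h'.2.1))
      (Finset.coe_injective (h.2.2.symm.trans h'.2.2)))
    (fun q hq => prob_edge_mono (hI q hq).1 (fun z hz => hW z (Finset.mem_sdiff.1 hz).1)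
      (fun z hz => hW z ((hI q hq).2.1 hz)) (by
        have := Finset.card_sdiff_add_card_eq_card (hI q hq).2.1
        have := (hI q hq).2.2
        omega))
  refine le_trans (prob_mono fun G hG => ?_) (hmain.trans (prob_mono fun G hG => ?_))
  · obtain ⟨hno, hex, hhit⟩ := hG
    -- The first alternative in `Hits` pays off here: without a hit, the majority part is at least
    -- half of the shell, so the pair belongs to `I`.
    unfold Hits at hhit
    push Not at hhit
    have hmf : (majShell G k).Finite := shell_finite.subset majShell_subset
    refine ⟨((cl_finite (G := G) (k := k) (z := x)).toFinset, hmf.toFinset), ?_,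
      ⟨hno, by simp, by simp⟩, ?_⟩
    · rw [Finset.mem_filter, Finset.mem_product, Finset.mem_powerset, Finset.mem_powerset,
        Set.Finite.toFinset_subset_toFinset, Set.Finite.toFinset_subset_toFinset,
        ← Set.ncard_eq_toFinset_card _ hmf, ← Set.ncard_eq_toFinset_card _ shell_finite]
      refine ⟨⟨?_, majShell_subset⟩, hhit.1⟩
      rw [← cell_eq_of_mem hxk]
      exact cl_subset_cell
    · intro hno'
      refine hex fun a ha z hz => ?_
      by_cases hzm : z ∈ majShell G k
      · exact hhit.2 a ha z hzm
      · exact hno' a (by simpa using ha) z (by simpa [W] using ⟨hz, hzm⟩)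
  · obtain ⟨q, -, ⟨hno, h1, h2⟩, hne⟩ := hG
    refine ⟨hno, Or.inr ?_⟩
    rw [h1, h2]
    exact hne

/-- The events of a first hit at scale `k` are disjoint, so their probabilities sum to at most `1`.
They dominate the probabilities of exits that miss, and the Borel–Cantelli lemma applies without any
independence between scales. -/
theorem ae_exit_imp_hit [NeZero N] (δ : ℝ) (c : ℕ → ℝ) (hx : x ∈ cell 0 m) :
    ∀ᵐ U ∂(law N), ∃ k₀, ∀ k, k₀ ≤ k → m ≤ k → NoHit x m k (graph N δ c U) →
      Exits x k (graph N δ c U) → Hits x k (graph N δ c U) := by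
  have hsum : ∑' i : ℕ, law N {U | NoHit x m (m + i) (graph N δ c U) ∧
      Hits x (m + i) (graph N δ c U)} ≤ 1 := by
    rw [← measure_iUnion]
    · exact MeasureTheory.prob_le_one
    · intro i j hij
      rw [Function.onFun, Set.disjoint_left]
      rintro U ⟨h1, h2⟩ ⟨h3, h4⟩
      rcases lt_or_gt_of_ne hij with hlt | hlt
      · exact h3 (m + i) (by omega) (by omega) h2
      · exact h1 (m + j) (by omega) (by omega) h4
    · intro i
      have h1 : LocalOn _ (NoHit x m (m + i)) := NoHit.localOn (k := m + i) hx
      have h2 : LocalOn _ (Hits x (m + i)) := Hits.localOn (cell_mono 0 (by omega) hx)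
      exact (h1.measurableSet ((cell_finite _ _).prod (cell_finite _ _)) δ c).inter
        (h2.measurableSet ((cell_finite _ _).prod (cell_finite _ _)) δ c)
  have hsum' : ∑' i : ℕ, law N {U | NoHit x m (m + i) (graph N δ c U) ∧
      Exits x (m + i) (graph N δ c U) ∧ ¬ Hits x (m + i) (graph N δ c U)} ≠ ⊤ := by
    refine ne_top_of_le_ne_top ENNReal.one_ne_top (le_trans ?_ hsum)
    exact ENNReal.tsum_le_tsum fun i => prob_exit_le_prob_hit hx (Nat.le_add_right m i)
  filter_upwards [ae_eventually_notMem hsum'] with U hU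
  obtain ⟨i₀, hi₀⟩ := Filter.eventually_atTop.1 hU
  refine ⟨m + i₀, fun k hk hmk hno hex => ?_⟩
  obtain ⟨i, rfl⟩ := Nat.exists_eq_add_of_le hmk
  by_contra hhit
  exact hi₀ i (by omega) ⟨hno, hex, hhit⟩

/-! ### The supercritical case -/

variable {A K : ℕ}

theorem IsBaseScale.tsum_le [NeZero N] (hN : 2 ≤ N) (hδ : -1 < δ) (h : IsBaseScale N δ A K)
    (hc : ∀ j, 1 ≤ j → (N : ℝ) ^ ((1 + δ) * K) ≤ c j) :
    ∑' i : ℕ, law N {U | ¬ Linked (graph N δ c U) (K + i)} ≤ ENNReal.ofReal (1 / 2) := by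
  have hs := summable_geometric_two.mul_left ((1 / 2 : ℝ) ^ K)
  calc ∑' i : ℕ, law N {U | ¬ Linked (graph N δ c U) (K + i)}
      ≤ ∑' i : ℕ, ENNReal.ofReal ((1 / 2) ^ K * (1 / 2) ^ i) := by
        refine ENNReal.tsum_le_tsum fun i => ?_
        rw [← pow_add]
        exact h.prob_not_linked_le hN hδ hc (Nat.le_add_right K i)
    _ = ENNReal.ofReal (∑' i : ℕ, (1 / 2) ^ K * (1 / 2) ^ i) :=
        (ENNReal.ofReal_tsum_of_nonneg (fun _ => by positivity) hs).symm
    _ ≤ ENNReal.ofReal (1 / 2) := by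
        refine ENNReal.ofReal_le_ofReal ?_
        rw [tsum_mul_left, tsum_geometric_two]
        -- The geometric tail is `2 * (1 / 2) ^ K`, so `K ≥ 4` is more than enough.
        have : (1 / 2 : ℝ) ^ K ≤ (1 / 2) ^ 4 :=
          pow_le_pow_of_le_one (by norm_num) (by norm_num) h.four_le
        norm_num at this ⊢
        linarith

theorem IsBaseScale.ae_linked [NeZero N] (hN : 2 ≤ N) (hδ : -1 < δ) (h : IsBaseScale N δ A K)
    (hc : ∀ j, 1 ≤ j → (N : ℝ) ^ ((1 + δ) * K) ≤ c j) :
    ∀ᵐ U ∂(law N), ∃ m, ∀ k, m ≤ k → Linked (graph N δ c U) k := by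
  filter_upwards [ae_eventually_notMem
    (ne_top_of_le_ne_top ENNReal.ofReal_ne_top (h.tsum_le hN hδ hc))] with U hU
  obtain ⟨i₀, hi₀⟩ := Filter.eventually_atTop.1 hU
  refine ⟨K + i₀, fun k hk => ?_⟩
  obtain ⟨i, rfl⟩ := Nat.exists_eq_add_of_le (show K ≤ k by omega)
  exact not_not.1 (hi₀ i (by omega))

theorem IsBaseScale.prob_linked_pos [NeZero N] (hN : 2 ≤ N) (hδ : -1 < δ)
    (h : IsBaseScale N δ A K) (hc : ∀ j, 1 ≤ j → (N : ℝ) ^ ((1 + δ) * K) ≤ c j) :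
    0 < law N {U | ∀ k, K ≤ k → Linked (graph N δ c U) k} := by
  by_contra h0
  have h0 : law N {U | ∀ k, K ≤ k → Linked (graph N δ c U) k} = 0 := by simpa using h0
  have h1 : law N (⋃ i : ℕ, {U | ¬ Linked (graph N δ c U) (K + i)}) ≤ ENNReal.ofReal (1 / 2) :=
    (measure_iUnion_le _).trans (h.tsum_le hN hδ hc)
  have h2 : (Set.univ : Set (Sample N)) ⊆ {U | ∀ k, K ≤ k → Linked (graph N δ c U) k} ∪
      ⋃ i : ℕ, {U | ¬ Linked (graph N δ c U) (K + i)} := by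
    intro U _
    by_cases hU : ∀ k, K ≤ k → Linked (graph N δ c U) k
    · exact Or.inl hU
    · push Not at hU
      obtain ⟨k, hk, hn⟩ := hU
      obtain ⟨i, rfl⟩ := Nat.exists_eq_add_of_le hk
      exact Or.inr (Set.mem_iUnion.2 ⟨i, hn⟩)
  have h3 := (measure_mono (μ := law N) h2).trans (measure_union_le _ _)
  rw [h0, zero_add, measure_univ] at h3
  have h4 := h3.trans h1
  rw [← ENNReal.ofReal_one, ENNReal.ofReal_le_ofReal_iff (by norm_num)] at h4
  norm_num at h4

/-- The `K`-ball is complete, so the origin belongs to its majority cluster with certainty; this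
brings the origin into the chain. -/
theorem inMajority_zero_of_base [NeZero N] (hδ : -1 < δ)
    (hc : ∀ j, 1 ≤ j → (N : ℝ) ^ ((1 + δ) * K) ≤ c j) (U : Sample N) :
    InMajority (graph N δ c U) K 0 := by
  rw [InMajority, cl_graph_eq_cell hδ hc U le_rfl, cell_ncard]
  have : 0 < N ^ K := pow_pos (NeZero.pos N) K
  omega

theorem IsBaseScale.percolates [NeZero N] (hN : 2 ≤ N) (hδ : -1 < δ) (h : IsBaseScale N δ A K)
    (hc : ∀ j, 1 ≤ j → (N : ℝ) ^ ((1 + δ) * K) ≤ c j) : Percolates N δ c :=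
  (h.prob_linked_pos hN hδ hc).trans_le <| measure_mono fun U hU =>
    infinite_of_linked hN hU (mem_cell_self 0 K) (inMajority_zero_of_base hδ hc U)

theorem IsBaseScale.ae_chainFrom [NeZero N] (hN : 2 ≤ N) (hδ : -1 < δ) (h : IsBaseScale N δ A K)
    (hc : ∀ j, 1 ≤ j → (N : ℝ) ^ ((1 + δ) * K) ≤ c j) {γ : ℝ} (hγ : γ < 1) :
    ∀ᵐ U ∂(law N), ∃ m, ChainFrom (graph N δ c U) γ m := by
  filter_upwards [h.ae_linked hN hδ hc] with U ⟨m, hU⟩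
  obtain ⟨y, hy, my⟩ := (hU m le_rfl).exists_inMajority (mem_cell_self 0 (m + 1))
  obtain ⟨n, -, hn⟩ := exists_chainFrom hN hU hy my hγ
  exact ⟨n, hn⟩

theorem IsBaseScale.chainFrom_zero_pos [NeZero N] (hN : 2 ≤ N) (hδ : -1 < δ)
    (h : IsBaseScale N δ A K) (hc : ∀ j, 1 ≤ j → (N : ℝ) ^ ((1 + δ) * K) ≤ c j) {γ : ℝ}
    (hγ : γ < 1) :
    0 < law N {U | ∃ m, ChainFrom (graph N δ c U) γ m ∧
      ∀ C, IsLargestCluster (graph N δ c U) (kseq m) C → 0 ∈ C} := by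
  refine (h.prob_linked_pos hN hδ hc).trans_le (measure_mono fun U hU => ?_)
  have h0 := inMajority_zero_of_base hδ hc U
  obtain ⟨n, hKn, hn⟩ := exists_chainFrom hN hU (mem_cell_self 0 K) h0 hγ
  refine ⟨n, hn, fun C hC => ?_⟩
  have hm := Linked.inMajority_of_le hU (mem_cell_self 0 K) h0 hKn
  rw [(hm.isLargestCluster_iff (mem_cell_self 0 _)).1 hC]
  exact self_mem_cl

theorem IsBaseScale.ae_existsUnique [NeZero N] (hN : 2 ≤ N) (hδ : -1 < δ)
    (h : IsBaseScale N δ A K) (hc : ∀ j, 1 ≤ j → (N : ℝ) ^ ((1 + δ) * K) ≤ c j) :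
    ∀ᵐ U ∂(law N), ∃! C : (graph N δ c U).ConnectedComponent, C.supp.Infinite := by
  have hex : ∀ᵐ U ∂(law N), ∀ x : HGroup N, ∀ m : ℕ, x ∈ cell 0 m →
      ∃ k₀, ∀ k, k₀ ≤ k → m ≤ k → NoHit x m k (graph N δ c U) →
        Exits x k (graph N δ c U) → Hits x k (graph N δ c U) := by
    -- There are countably many vertices and scales, so one null set serves for all of them.
    rw [ae_all_iff]
    intro x
    rw [ae_all_iff]
    intro m
    by_cases hx : x ∈ cell 0 m
    · filter_upwards [ae_exit_imp_hit δ c hx] with U hU _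
      exact hU
    · exact Filter.Eventually.of_forall fun U h => absurd h hx
  filter_upwards [hex, h.ae_linked hN hδ hc] with U hU ⟨m₀, hm₀⟩
  obtain ⟨y, hy, my⟩ := (hm₀ m₀ le_rfl).exists_inMajority (mem_cell_self 0 (m₀ + 1))
  refine ⟨(graph N δ c U).connectedComponentMk y, infinite_of_linked hN hm₀ hy my, ?_⟩
  intro C hC
  induction C using SimpleGraph.ConnectedComponent.ind with
  | _ x =>
    rw [SimpleGraph.ConnectedComponent.eq]
    -- The starting scale must depend on `x`, because the ball around the origin has to contain `x`
    -- before its exits are watched.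
    have hm : ∀ k, max m₀ (hdist 0 x) ≤ k → Linked (graph N δ c U) k :=
      fun k hk => hm₀ k ((le_max_left _ _).trans hk)
    have hx : x ∈ cell 0 (max m₀ (hdist 0 x)) :=
      mem_cell.2 (le_max_right _ _)
    exact reachable_of_linked hm (cell_mono 0 (le_max_left _ _) hy)
      (Linked.inMajority_of_le hm₀ hy my (le_max_left _ _)) hx hC (hU x _ hx)

/-! ### The subcritical case -/

theorem prob_adj_shell_le [NeZero N] {b : ℝ} (hb : ∀ j, 1 ≤ j → c j ≤ b) {j : ℕ} (hkj : k ≤ j) :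
    prob N δ c (fun G => ¬ NoEdge (cell 0 k) (shell N j) G) ≤
      ENNReal.ofReal ((N : ℝ) ^ k * (N : ℝ) ^ (j + 1) *
        (b / (N : ℝ) ^ (((j + 1 : ℕ) : ℝ) * (1 + δ)))) := by
  classical
  let I : Finset (HGroup N × HGroup N) :=
    (cell_finite (0 : HGroup N) k).toFinset ×ˢ (shell_finite (N := N) (k := j)).toFinset
  have hcard : I.card ≤ N ^ k * N ^ (j + 1) := by
    rw [Finset.card_product, ← Set.ncard_eq_toFinset_card _ (cell_finite 0 k),
      ← Set.ncard_eq_toFinset_card _ shell_finite, cell_ncard, ← cell_ncard (0 : HGroup N) (j + 1)]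
    exact Nat.mul_le_mul_left _
      (Set.ncard_le_ncard (fun _ h => h.1) (cell_finite 0 (j + 1)))
  have h1 := prob_exists_mem_le_mul (N := N) (δ := δ) (c := c) I (fun p G => G.Adj p.1 p.2)
    (q := ENNReal.ofReal (b / (N : ℝ) ^ (((j + 1 : ℕ) : ℝ) * (1 + δ)))) (fun p hp => by
      rw [Finset.mem_product, Set.Finite.mem_toFinset, Set.Finite.mem_toFinset] at hp
      refine (prob_adj_le _ _).trans (ENNReal.ofReal_le_ofReal ?_)
      rw [hdist_of_mem_shell hp.1 hkj hp.2]
      refine (min_le_left _ _).trans ?_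
      exact div_le_div_of_nonneg_right (hb _ (by omega)) (Real.rpow_nonneg (by positivity) _))
  refine (prob_mono fun G hG => ?_).trans (h1.trans ?_)
  · unfold NoEdge at hG
    push Not at hG
    obtain ⟨y, hy, z, hz, hadj⟩ := hG
    refine ⟨(y, z), ?_, hadj⟩
    rw [Finset.mem_product, Set.Finite.mem_toFinset, Set.Finite.mem_toFinset]
    exact ⟨hy, hz⟩
  · rw [ENNReal.ofReal_mul (by positivity)]
    refine mul_le_mul_left ?_ _
    rw [← ENNReal.ofReal_natCast]
    refine ENNReal.ofReal_le_ofReal ?_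
    exact_mod_cast hcard

/-- A first-moment bound on the edges that leave the `k`-ball, summed over the shells beyond it. -/
theorem not_percolates [NeZero N] (hN : 2 ≤ N) (hδ : 1 < δ) (hb : BddAbove (c '' Set.Ici 1)) :
    ¬ Percolates N δ c := by
  obtain ⟨b, hb⟩ := hb
  have hb : ∀ j, 1 ≤ j → c j ≤ max b 0 := fun j hj =>
    (hb (Set.mem_image_of_mem c hj)).trans (le_max_left _ _)
  set b' := max b 0
  have hb0 : 0 ≤ b' := le_max_right _ _
  have hN1 : (2 : ℝ) ≤ N := by exact_mod_cast hN
  have hN0 : (0 : ℝ) < N := by linarith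
  set ρ : ℝ := (N : ℝ) ^ (1 - δ) with hρ
  have hρ0 : 0 ≤ ρ := Real.rpow_nonneg hN0.le _
  have hρ1 : ρ < 1 := Real.rpow_lt_one_of_one_lt_of_neg (by linarith) (by linarith)
  have hterm : ∀ k i : ℕ, (N : ℝ) ^ k * (N : ℝ) ^ (k + i + 1) *
      (b' / (N : ℝ) ^ (((k + i + 1 : ℕ) : ℝ) * (1 + δ))) ≤ b' * ρ ^ k * (1 / 2) ^ i := by
    intro k i
    have e1 : (N : ℝ) ^ k * (N : ℝ) ^ (k + i + 1) *
        (b' / (N : ℝ) ^ (((k + i + 1 : ℕ) : ℝ) * (1 + δ))) =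
        b' * (N : ℝ) ^ ((k : ℝ) - ((k + i + 1 : ℕ) : ℝ) * δ) := by
      rw [← pow_add, ← Real.rpow_natCast, mul_div_assoc', mul_comm _ b', mul_div_assoc,
        ← Real.rpow_sub hN0]
      congr 2
      push_cast
      ring
    -- The factor in `k` gives the decay `ρ ^ k`, and the factor in `i` makes the sum over shells
    -- converge.
    have e2 : (N : ℝ) ^ ((k : ℝ) - ((k + i + 1 : ℕ) : ℝ) * δ) ≤
        (N : ℝ) ^ ((1 - δ) * k + -(i : ℝ)) := by
      refine Real.rpow_le_rpow_of_exponent_le (by linarith) ?_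
      push_cast
      have : (0 : ℝ) ≤ i := by positivity
      nlinarith
    rw [Real.rpow_add hN0, Real.rpow_mul hN0.le, Real.rpow_natCast, Real.rpow_neg hN0.le,
      Real.rpow_natCast, ← hρ] at e2
    have e3 : ((N : ℝ) ^ i)⁻¹ ≤ (1 / 2) ^ i := by
      rw [one_div, inv_pow]
      exact inv_anti₀ (by positivity) (by gcongr)
    rw [e1, mul_assoc]
    refine mul_le_mul_of_nonneg_left (e2.trans ?_) hb0
    exact mul_le_mul_of_nonneg_left e3 (by positivity)
  have hbound : ∀ k : ℕ, law N {U | ((graph N δ c U).connectedComponentMk 0).supp.Infinite} ≤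
      ENNReal.ofReal (b' * ρ ^ k * 2) := by
    intro k
    have hsub : {U | ((graph N δ c U).connectedComponentMk 0).supp.Infinite} ⊆
        ⋃ i : ℕ, {U | ¬ NoEdge (cell 0 k) (shell N (k + i)) (graph N δ c U)} := by
      intro U hU
      obtain ⟨y, hy, z, hz, hadj⟩ := exists_adj_of_infinite (cell_finite 0 k)
        (mem_cell_self 0 k) hU
      have hlt : k < hdist 0 z := not_le.1 hz
      refine Set.mem_iUnion.2 ⟨hdist 0 z - 1 - k, fun hno => hno y hy z ⟨?_, ?_⟩ hadj⟩
      · rw [mem_cell]; omega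
      · rw [mem_cell]; omega
    have hs := summable_geometric_two.mul_left (b' * ρ ^ k)
    calc law N {U | ((graph N δ c U).connectedComponentMk 0).supp.Infinite}
        ≤ ∑' i : ℕ, law N {U | ¬ NoEdge (cell 0 k) (shell N (k + i)) (graph N δ c U)} :=
          (measure_mono hsub).trans (measure_iUnion_le _)
      _ ≤ ∑' i : ℕ, ENNReal.ofReal (b' * ρ ^ k * (1 / 2) ^ i) := by
          refine ENNReal.tsum_le_tsum fun i => ?_
          exact (prob_adj_shell_le hb (Nat.le_add_right k i)).trans
            (ENNReal.ofReal_le_ofReal (hterm k i))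
      _ = ENNReal.ofReal (∑' i : ℕ, b' * ρ ^ k * (1 / 2) ^ i) :=
          (ENNReal.ofReal_tsum_of_nonneg (fun _ => by positivity) hs).symm
      _ = ENNReal.ofReal (b' * ρ ^ k * 2) := by rw [tsum_mul_left, tsum_geometric_two]
  have hlim : Filter.Tendsto (fun k : ℕ => ENNReal.ofReal (b' * ρ ^ k * 2)) Filter.atTop
      (nhds 0) := by
    have h1 := ((tendsto_pow_atTop_nhds_zero_of_lt_one hρ0 hρ1).const_mul b').mul_const 2
    rw [mul_zero, zero_mul] at h1
    have h2 := ENNReal.tendsto_ofReal h1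
    rwa [ENNReal.ofReal_zero] at h2
  exact fun h => absurd (ge_of_tendsto' hlim hbound) (not_le.2 h)

end

end HierPerc

theorem theorem3p1 (N : ℕ) (hN : 2 ≤ N) (δ : ℝ) (hδ : -1 < δ) :
    (1 < δ → ∀ c : ℕ → ℝ, (∀ k, 1 ≤ k → 0 < c k) → BddAbove (c '' Set.Ici 1) →
      ¬ HierPerc.Percolates N δ c) ∧
    (δ < 1 → ∃ c₀ : ℝ, ∀ c : ℕ → ℝ, (∀ k, 1 ≤ k → 0 < c k) → c₀ ≤ sInf (c '' Set.Ici 1) →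
      HierPerc.Percolates N δ c ∧
      (∀ γ : ℝ, (1 + δ) / 2 < γ → γ < 1 →
        (∀ᵐ U ∂(HierPerc.law N), ∃ m, HierPerc.ChainFrom (HierPerc.graph N δ c U) γ m) ∧
        0 < HierPerc.law N {U | ∃ m, HierPerc.ChainFrom (HierPerc.graph N δ c U) γ m ∧
          ∀ C, HierPerc.IsLargestCluster (HierPerc.graph N δ c U) (HierPerc.kseq m) C → 0 ∈ C}) ∧
      (∀ᵐ U ∂(HierPerc.law N),
        ∃! C : (HierPerc.graph N δ c U).ConnectedComponent, C.supp.Infinite)) := by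
  have : NeZero N := ⟨by omega⟩
  refine ⟨fun h c _ hb => HierPerc.not_percolates hN h hb, fun h => ?_⟩
  obtain ⟨A, K, hK⟩ := HierPerc.exists_isBaseScale hN h
  refine ⟨(N : ℝ) ^ ((1 + δ) * K), fun c hpos hinf => ?_⟩
  -- A real `sInf` bounds the elements from below only for sets that are bounded below; positivity
  -- of `c` provides this.
  have hbdd : BddBelow (c '' Set.Ici 1) := by
    refine ⟨0, ?_⟩
    rintro _ ⟨k, hk, rfl⟩
    exact (hpos k hk).le
  have hc : ∀ j, 1 ≤ j → (N : ℝ) ^ ((1 + δ) * K) ≤ c j := fun j hj =>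
    hinf.trans (csInf_le hbdd (Set.mem_image_of_mem c hj))
  exact ⟨hK.percolates hN hδ hc, fun γ _ hγ => ⟨hK.ae_chainFrom hN hδ hc hγ,
    hK.chainFrom_zero_pos hN hδ hc hγ⟩, hK.ae_existsUnique hN hδ hc⟩
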